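/- **Theorem 2 (semi-ellipse type bound).** Let $\Omega\subset\mathbb R^2$ be the cross-section (in the coordinates $(y,z)$) of a flow along $x$, whose boundary consists of periodic, impermeable and/or free-surface parts. Let $\overline u,\overline B,\overline\rho,\overline q$ be real functions on $\Omega$ (streamwise velocity, streamwise magnetic field, density, total pressure), $C^1$, bounded with bounded first derivatives and periodic in the periodic directions; let $G$ be a $C^2$ potential with bounded gradient, and let $\gamma,\mu_0>0$ be constants. Assume that $\overline\rho$ and $\overline p=\overline q-\overline B^2/(2\mu_0)$ are bounded below by positive constants and that $\nabla\overline q=\overline\rho\,\nabla G$. Put $$s=\sqrt{\gamma\overline p/\overline\rho},\qquad a=\overline B/\sqrt{\mu_0\overline\rho},\qquad N_1^2=\frac{G_y\overline\rho_y}{\overline\rho}-\frac{G_y^2}{s^2},\quad N_2^2=\frac{G_z\overline\rho_z}{\overline\rho}-\frac{G_z^2}{s^2},\quad N_{12}^2=\frac{G_z\overline\rho_y}{\overline\rho}-\frac{G_yG_z}{s^2},$$ $$\overline u_\pm=\tfrac12\bigl(\max_\Omega\overline u\pm\min_\Omega\overline u\bigr),\qquad a_M^2=\max_\Omega a^2,\qquad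 J=\frac{N_1^2+N_2^2}{\overline u_y^2+\overline u_z^2},\qquad J_m=\min_\Omega J,$$ where the minimum $J_m$ is over the points with $\nabla\overline u\ne0$, and minima and maxima are understood as infima and suprema, and $$\lambda_M=\max_\Omega\tfrac12\Bigl(\sqrt{T^2+4J_m\bigl(\overline u_z^2N_1^2+\overline u_y^2N_2^2-2\overline u_y\overline u_zN_{12}^2\bigr)}-T\Bigr),\qquad T=N_1^2+N_2^2-J_m(\overline u_y^2+\overline u_z^2).$$ Let $k>0$ and let $c=c_r+ic_i$ with $c_i\neq0$ be the complex phase speed of an unstable mode, that is, with $U=\overline u-c$ there are complex amplitudes $(\tilde v^x,\tilde v^y,\tilde v^z,\tilde b^x,\tilde b^y,\tilde b^z,\tilde\rho,\tilde q)$ on $\Omega$, not all identically zero, periodic in the periodic directions, with $\tilde v^y,\tilde v^z,\tilde b^y,\tilde b^z,\tilde q$ of class $C^1$, solving the linearised ideal compressible magnetohydrodynamic equations $$\begin{aligned} &\overline\rho\{ikU\tilde v^x+\tilde v^y\overline u_y+\tilde v^z\overline u_z\}-\tfrac1{\mu_0}\{ik\overline B\tilde b^x+\tilde b^y\overline B_y+\tilde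 b^z\overline B_z\}+ik\tilde q=0,\\ &\overline\rho\, ikU\tilde v^y-\tfrac1{\mu_0}ik\overline B\tilde b^y+\tilde q_y-G_y\tilde\rho=0,\qquad \overline\rho\, ikU\tilde v^z-\tfrac1{\mu_0}ik\overline B\tilde b^z+\tilde q_z-G_z\tilde\rho=0,\\ &ikU\tilde b^x+\tilde v^y\overline B_y+\tilde v^z\overline B_z-\{ik\overline B\tilde v^x+\tilde b^y\overline u_y+\tilde b^z\overline u_z\}+\overline B(ik\tilde v^x+\tilde v^y_y+\tilde v^z_z)=0,\\ &ikU\tilde b^y-ik\overline B\tilde v^y=0,\qquad ikU\tilde b^z-ik\overline B\tilde v^z=0,\qquad ik\tilde b^x+\tilde b^y_y+\tilde b^z_z=0,\\ &ikU\tilde\rho+\tilde v^y\overline\rho_y+\tilde v^z\overline\rho_z+\overline\rho(ik\tilde v^x+\tilde v^y_y+\tilde v^z_z)=0,\\ &ikU\bigl(s^2\tilde\rho+\tfrac{\overline B\tilde b^x}{\mu_0}-\tilde q\bigr)+\tilde v^y\bigl(s^2\overline\rho_y+\tfrac{\overline B\,\overline B_y}{\mu_0}-G_y\overline\rho\bigr)+\tilde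 v^z\bigl(s^2\overline\rho_z+\tfrac{\overline B\,\overline B_z}{\mu_0}-G_z\overline\rho\bigr)=0, \end{aligned}$$ such that the displacement $(\eta,\zeta)=(\tilde v^y,\tilde v^z)/(ikU)$ and its divergence $\eta_y+\zeta_z$ are square integrable over $\Omega$ (one period), the normal component of $(\eta,\zeta)$ vanishes (in the weak sense) on the impermeable boundary, and $\tilde q=0$ on the free surface, if there is one. Assume $N_1^2+N_2^2\ge0$ everywhere in $\Omega$. Put $\mu=1-\lambda_M/(k^2c_i^2)$. Then $$(c_r-\overline u_+)^2+\Gamma c_i^2\le\overline u_-^2-\min_\Omega\min\Bigl(a^2,\frac{c_i^4}{s^2}\Bigr),$$ where $$\Gamma=\max\Bigl(1,\ \mu+4\mu^2J_m\Bigl\{1+\sqrt{1+\mu\bigl(a_M^2/c_i^2-4J_m\bigr)}\Bigr\}^{-2}\Bigr)\ \text{ if }\mu>0,\qquad \Gamma=1\ \text{ otherwise};$$ for $\mu>0$ the argument of the square root is positive. If $J_m>\frac14$, then moreover $$c_i^2<\frac{(4J_mk^{-2}\lambda_M+a_M^2)+\sqrt{(4J_mk^{-2}\lambda_M+a_M^2)^2-4(4J_m-1)k^{-2}\lambda_Ma_M^2}}{2(4J_m-1)}.$$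 -/

import Mathlib

open MeasureTheory Set Filter Topology

noncomputable section

namespace MagnetoShear

/-- Partial derivative in the first transverse coordinate `y` of `(y, z)`. -/
def dy {E : Type*} [NormedAddCommGroup E] [NormedSpace ℝ E] (f : ℝ × ℝ → E) (x : ℝ × ℝ) : E :=
  fderiv ℝ f x (1, 0)

/-- Partial derivative in the second transverse coordinate `z` of `(y, z)`. -/
def dz {E : Type*} [NormedAddCommGroup E] [NormedSpace ℝ E] (f : ℝ × ℝ → E) (x : ℝ × ℝ) : E :=
  fderiv ℝ f x (0, 1)

/-- The transverse cross-section of the flow.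

`D` is the open set of the `(y, z)`-plane filled by fluid, continued periodically in the
periodic directions; `periods` is the discrete group of its periods (`⊥` if no part of the boundary
is periodic, rank one or two otherwise), and `cell` is one period of `D` (`D` itself if
`periods = ⊥`), the set over which one integrates. `free` is the part of the boundary of `D`
(possibly empty) that is a free surface; the rest of the boundary is impermeable. -/
structure CrossSection where
  D : Set (ℝ × ℝ)
  periods : AddSubgroup (ℝ × ℝ)
  cell : Set (ℝ × ℝ)
  free : Set (ℝ × ℝ)
  isOpen_D : IsOpen D
  discrete_periods : DiscreteTopology periods
  add_mem_D : ∀ l ∈ periods, ∀ x ∈ D, x + l ∈ D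
  cell_subset : cell ⊆ D
  isFundamentalDomain : IsAddFundamentalDomain periods cell (volume.restrict D)
  free_subset : free ⊆ frontier D

/-- Invariance of a field on `D` under the periods. -/
def CrossSection.IsPeriodic (R : CrossSection) {E : Type*} (f : ℝ × ℝ → E) : Prop :=
  ∀ l ∈ R.periods, ∀ x ∈ R.D, f (x + l) = f x

/-- `f` is continuously differentiable on `D`, and `f` and its first derivatives are bounded. -/
def CrossSection.IsBoundedC1 (R : CrossSection) (f : ℝ × ℝ → ℝ) : Prop :=
  ContDiffOn ℝ 1 f R.D ∧ ∃ C : ℝ, ∀ x ∈ R.D, |f x| ≤ C ∧ |dy f x| ≤ C ∧ |dz f x| ≤ C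

/-- The data of a base state: streamwise velocity `u`, streamwise magnetic field `B`, density `ρ`,
total pressure `q`, potential `G` of the body force, adiabatic exponent `γ` and vacuum
permeability `μ₀`. -/
structure BaseState where
  u : ℝ × ℝ → ℝ
  B : ℝ × ℝ → ℝ
  ρ : ℝ × ℝ → ℝ
  q : ℝ × ℝ → ℝ
  G : ℝ × ℝ → ℝ
  γ : ℝ
  μ₀ : ℝ

namespace BaseState

variable (S : BaseState)

/-- Kinematic pressure. -/
def p (x : ℝ × ℝ) : ℝ := S.q x - S.B x ^ 2 / (2 * S.μ₀)

/-- Local sound speed. -/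
def s (x : ℝ × ℝ) : ℝ := Real.sqrt (S.γ * S.p x / S.ρ x)

/-- Local Alfvén speed. -/
def a (x : ℝ × ℝ) : ℝ := S.B x / Real.sqrt (S.μ₀ * S.ρ x)

/-- The buoyancy frequency `N₁²`. -/
def N1sq (x : ℝ × ℝ) : ℝ := dy S.G x * dy S.ρ x / S.ρ x - dy S.G x ^ 2 / S.s x ^ 2

/-- The buoyancy frequency `N₂²`. -/
def N2sq (x : ℝ × ℝ) : ℝ := dz S.G x * dz S.ρ x / S.ρ x - dz S.G x ^ 2 / S.s x ^ 2

/-- The buoyancy frequency `N₁₂²`. -/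
def N12sq (x : ℝ × ℝ) : ℝ := dz S.G x * dy S.ρ x / S.ρ x - dy S.G x * dz S.G x / S.s x ^ 2

/-- The squared shear `u_y² + u_z²`. -/
def shearSq (x : ℝ × ℝ) : ℝ := dy S.u x ^ 2 + dz S.u x ^ 2

/-- The net Richardson number `J`, meaningful where the shear does not vanish. -/
def J (x : ℝ × ℝ) : ℝ := (S.N1sq x + S.N2sq x) / S.shearSq x

/-- An admissible base state on the cross-section `R`: a magneto-static equilibrium with positive
density and pressure (uniformly, as for continuous positive functions up to the boundary). -/
structure IsAdmissible (R : CrossSection) : Prop where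
  γ_pos : 0 < S.γ
  μ₀_pos : 0 < S.μ₀
  u_reg : R.IsBoundedC1 S.u
  B_reg : R.IsBoundedC1 S.B
  ρ_reg : R.IsBoundedC1 S.ρ
  q_reg : R.IsBoundedC1 S.q
  G_reg : ContDiffOn ℝ 2 S.G R.D
  G_bdd : ∃ C : ℝ, ∀ x ∈ R.D, |dy S.G x| ≤ C ∧ |dz S.G x| ≤ C
  ρ_pos : ∃ ε > 0, ∀ x ∈ R.D, ε ≤ S.ρ x
  p_pos : ∃ ε > 0, ∀ x ∈ R.D, ε ≤ S.p x
  u_periodic : R.IsPeriodic S.u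
  B_periodic : R.IsPeriodic S.B
  ρ_periodic : R.IsPeriodic S.ρ
  q_periodic : R.IsPeriodic S.q
  magnetostatic_y : ∀ x ∈ R.D, dy S.q x - S.ρ x * dy S.G x = 0
  magnetostatic_z : ∀ x ∈ R.D, dz S.q x - S.ρ x * dz S.G x = 0

/-- `u₊`, half the sum of the maximum and the minimum of the base velocity. -/
def uPlus (R : CrossSection) : ℝ := (sSup (S.u '' R.D) + sInf (S.u '' R.D)) / 2

/-- `u₋`, half the difference of the maximum and the minimum of the base velocity. -/
def uMinus (R : CrossSection) : ℝ := (sSup (S.u '' R.D) - sInf (S.u '' R.D)) / 2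

/-- `a_M²`, the maximum of the squared Alfvén speed. -/
def aMsq (R : CrossSection) : ℝ := sSup ((fun x => S.a x ^ 2) '' R.D)

/-- `J_m`, the minimum of the net Richardson number, taken over the points where it is defined. -/
def Jm (R : CrossSection) : ℝ := sInf (S.J '' {x ∈ R.D | S.shearSq x ≠ 0})

/-- The quantity whose maximum is `λ_M`:
`½ (√((u_y² + u_z²)² (J - J_m)² + 4 u_y² u_z² J_m (J₁ + J₂ - 2 J₁₂)) - (u_y² + u_z²) (J - J_m))`,
where `J₁ = N₁² / u_y²`, `J₂ = N₂² / u_z²`, `J₁₂ = N₁₂² / (u_y u_z)`. All products are multiplied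
out, so that the expression makes sense also where `u_y` or `u_z` vanishes:
`(u_y² + u_z²) (J - J_m) = N₁² + N₂² - J_m (u_y² + u_z²)` and
`u_y² u_z² (J₁ + J₂ - 2 J₁₂) = u_z² N₁² + u_y² N₂² - 2 u_y u_z N₁₂²`. -/
def misalignment (R : CrossSection) (x : ℝ × ℝ) : ℝ :=
  (Real.sqrt ((S.N1sq x + S.N2sq x - S.Jm R * S.shearSq x) ^ 2
      + 4 * S.Jm R * (dz S.u x ^ 2 * S.N1sq x + dy S.u x ^ 2 * S.N2sq x
          - 2 * dy S.u x * dz S.u x * S.N12sq x))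
    - (S.N1sq x + S.N2sq x - S.Jm R * S.shearSq x)) / 2

/-- `λ_M`. -/
def lamM (R : CrossSection) : ℝ := sSup (S.misalignment R '' R.D)

/-- `min_Ω min (a², c_i⁴ / s²)`. -/
def Θ (R : CrossSection) (c : ℂ) : ℝ :=
  sInf ((fun x => min (S.a x ^ 2) (c.im ^ 4 / S.s x ^ 2)) '' R.D)

/-- `μ = 1 - λ_M / (k² c_i²)`. -/
def μ (R : CrossSection) (k : ℝ) (c : ℂ) : ℝ := 1 - S.lamM R / (k ^ 2 * c.im ^ 2)

/-- The argument `1 + μ (a_M² / c_i² - 4 J_m)` of the square root in `Γ`. -/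
def radicand (R : CrossSection) (k : ℝ) (c : ℂ) : ℝ :=
  1 + S.μ R k c * (S.aMsq R / c.im ^ 2 - 4 * S.Jm R)

open Classical in
/-- The coefficient `Γ` of `c_i²`. -/
def Gam (R : CrossSection) (k : ℝ) (c : ℂ) : ℝ :=
  if 0 < S.μ R k c then
    max 1 (S.μ R k c + 4 * S.μ R k c ^ 2 * S.Jm R
      * ((1 + Real.sqrt (S.radicand R k c)) ^ 2)⁻¹)
  else 1

/-- The upper bound of `c_i²` for `J_m > 1/4`. -/
def ciSqBound (R : CrossSection) (k : ℝ) : ℝ :=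
  ((4 * S.Jm R * (S.lamM R / k ^ 2) + S.aMsq R)
    + Real.sqrt ((4 * S.Jm R * (S.lamM R / k ^ 2) + S.aMsq R) ^ 2
        - 4 * (4 * S.Jm R - 1) * (S.lamM R / k ^ 2) * S.aMsq R))
  / (2 * (4 * S.Jm R - 1))

end BaseState

/-- Amplitudes of a normal mode perturbation `(…) e^{ik(x - ct)}`: velocity, magnetic field,
density and total pressure. -/
structure Perturbation where
  vx : ℝ × ℝ → ℂ
  vy : ℝ × ℝ → ℂ
  vz : ℝ × ℝ → ℂ
  bx : ℝ × ℝ → ℂ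
  bY : ℝ × ℝ → ℂ
  bz : ℝ × ℝ → ℂ
  ρ : ℝ × ℝ → ℂ
  q : ℝ × ℝ → ℂ

/-- The shifted base velocity `U = u - c`. -/
def shifted (S : BaseState) (c : ℂ) (x : ℝ × ℝ) : ℂ := (S.u x : ℂ) - c

/-- The linearised ideal compressible magnetohydrodynamic equations at the point `x`. -/
structure Perturbation.SolvesLinearisedAt (w : Perturbation) (S : BaseState) (k : ℝ) (c : ℂ)
    (x : ℝ × ℝ) : Prop where
  momentum_x :
    S.ρ x * (shifted S c x * (Complex.I * k) * w.vx x
        + (w.vy x * dy S.u x + w.vz x * dz S.u x))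
      - 1 / S.μ₀ * (S.B x * (Complex.I * k) * w.bx x + (w.bY x * dy S.B x + w.bz x * dz S.B x))
      + Complex.I * k * w.q x = 0
  momentum_y :
    S.ρ x * (shifted S c x * (Complex.I * k) * w.vy x)
      - 1 / S.μ₀ * (S.B x * (Complex.I * k) * w.bY x)
      + (dy w.q x - dy S.G x * w.ρ x) = 0
  momentum_z :
    S.ρ x * (shifted S c x * (Complex.I * k) * w.vz x)
      - 1 / S.μ₀ * (S.B x * (Complex.I * k) * w.bz x)
      + (dz w.q x - dz S.G x * w.ρ x) = 0
  induction_x :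
    (shifted S c x * (Complex.I * k) * w.bx x + (w.vy x * dy S.B x + w.vz x * dz S.B x))
      - (S.B x * (Complex.I * k) * w.vx x + (w.bY x * dy S.u x + w.bz x * dz S.u x))
      + S.B x * (Complex.I * k * w.vx x + dy w.vy x + dz w.vz x) = 0
  induction_y :
    shifted S c x * (Complex.I * k) * w.bY x - S.B x * (Complex.I * k) * w.vy x = 0
  induction_z :
    shifted S c x * (Complex.I * k) * w.bz x - S.B x * (Complex.I * k) * w.vz x = 0
  gauss : Complex.I * k * w.bx x + dy w.bY x + dz w.bz x = 0
  mass :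
    shifted S c x * (Complex.I * k) * w.ρ x + (w.vy x * dy S.ρ x + w.vz x * dz S.ρ x)
      + S.ρ x * (Complex.I * k * w.vx x + dy w.vy x + dz w.vz x) = 0
  energy :
    shifted S c x * (Complex.I * k)
        * ((S.s x : ℂ) ^ 2 * w.ρ x + S.B x * w.bx x / S.μ₀ - w.q x)
      + w.vy x * ((S.s x : ℂ) ^ 2 * dy S.ρ x + S.B x * dy S.B x / S.μ₀ - dy S.G x * S.ρ x)
      + w.vz x * ((S.s x : ℂ) ^ 2 * dz S.ρ x + S.B x * dz S.B x / S.μ₀ - dz S.G x * S.ρ x) = 0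

/-- The component `η` of the Lagrangian displacement: `v^y = ik U η`. -/
def Perturbation.η (w : Perturbation) (S : BaseState) (k : ℝ) (c : ℂ) (x : ℝ × ℝ) : ℂ :=
  w.vy x / (Complex.I * k * shifted S c x)

/-- The component `ζ` of the Lagrangian displacement: `v^z = ik U ζ`. -/
def Perturbation.ζ (w : Perturbation) (S : BaseState) (k : ℝ) (c : ℂ) (x : ℝ × ℝ) : ℂ :=
  w.vz x / (Complex.I * k * shifted S c x)

/-- Periodic test functions of class `C¹ ∩ H¹` that vanish on the free surface. No condition is
imposed on the impermeable part of the boundary. -/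
structure CrossSection.IsTest (R : CrossSection) (χ : ℝ × ℝ → ℂ) : Prop where
  contDiffOn : ContDiffOn ℝ 1 χ R.D
  periodic : R.IsPeriodic χ
  memLp : MemLp χ 2 (volume.restrict R.cell)
  memLp_dy : MemLp (dy χ) 2 (volume.restrict R.cell)
  memLp_dz : MemLp (dz χ) 2 (volume.restrict R.cell)
  free : ∀ x ∈ R.free, Tendsto χ (𝓝[R.D] x) (𝓝 0)

/-- The normal component of the transverse vector field `(f, g)` vanishes on the impermeable part
of the boundary, in the weak sense: the normal trace of `(f, g)` annihilates every test function.
For fields that are `C¹` up to a piecewise smooth boundary this is the pointwise condition. -/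
def CrossSection.NormalComponentVanishes (R : CrossSection) (f g : ℝ × ℝ → ℂ) : Prop :=
  ∀ χ : ℝ × ℝ → ℂ, R.IsTest χ →
    ∫ x in R.cell, (χ x * (dy f x + dz g x) + (dy χ x * f x + dz χ x * g x)) = 0

/-- `w` is a normal mode with wavenumber `k` and complex phase speed `c`: a nontrivial, periodic
solution of the linearised equations on `D`, of finite energy, with vanishing normal displacement
on the impermeable boundary and vanishing total pressure on the free surface. -/
structure IsNormalMode (R : CrossSection) (S : BaseState) (k : ℝ) (c : ℂ) (w : Perturbation) :
    Prop where
  vy_reg : ContDiffOn ℝ 1 w.vy R.D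
  vz_reg : ContDiffOn ℝ 1 w.vz R.D
  bY_reg : ContDiffOn ℝ 1 w.bY R.D
  bz_reg : ContDiffOn ℝ 1 w.bz R.D
  q_reg : ContDiffOn ℝ 1 w.q R.D
  solves : ∀ x ∈ R.D, w.SolvesLinearisedAt S k c x
  periodic : R.IsPeriodic fun x =>
    (w.vx x, w.vy x, w.vz x, w.bx x, w.bY x, w.bz x, w.ρ x, w.q x)
  memLp_η : MemLp (w.η S k c) 2 (volume.restrict R.cell)
  memLp_ζ : MemLp (w.ζ S k c) 2 (volume.restrict R.cell)
  memLp_div : MemLp (fun x => dy (w.η S k c) x + dz (w.ζ S k c) x) 2 (volume.restrict R.cell)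
  impermeable : R.NormalComponentVanishes (w.η S k c) (w.ζ S k c)
  free_surface : ∀ x ∈ R.free, Tendsto w.q (𝓝[R.D] x) (𝓝 0)
  nontrivial : ∃ x ∈ R.D,
    (w.vx x, w.vy x, w.vz x, w.bx x, w.bY x, w.bz x, w.ρ x, w.q x) ≠ 0

end MagnetoShear

end

/-!
The mode is governed by the transverse displacement `(η, ζ)`: the linearised equations express
the perturbation of the total pressure through `(η, ζ)` and turn the transverse momentum equations
into a self-adjoint problem whose kinetic part carries the factor `U²`. Testing it against
`φ(u)` times the conjugate displacement gives a complex energy identity for every `C¹` weight `φ`.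

The weight `φ = 1` is Howard's semicircle argument; keeping the buoyancy energy instead of
discarding it bounds `(c_r - u₊)² + c_i² - u₋² + min (a², c_i⁴ / s²)` from above by minus the ratio
of buoyancy to kinetic energy. For `φ` the phase of `conj U` the imaginary part of the identity
compares the kinetic and buoyancy energies with the shear `h = η u_y + ζ u_z`, and completing two
squares turns it into a quadratic inequality for the mean ratio of shear to kinetic energy. The
buoyancy form is at least `J_m |h|² - λ_M (|η|² + |ζ|²)`, since the misalignment whose maximum is
`λ_M` is minus the smallest eigenvalue of `N - J_m ∇u ∇uᵀ`. Solving the quadratic inequality bounds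
the shear, hence the buoyancy energy, from below, which is the gain `Γ - 1`; positivity of its
discriminant is the bound of `c_i²`.
-/

noncomputable section

namespace MagnetoShear

open Complex ComplexConjugate

/-! ### Hermitian forms in two variables and the energy inequality -/

/-- The Hermitian form `a |η|² + b |ζ|² + 2 d Re (η conj ζ)` of the real symmetric matrix with
diagonal `a`, `b` and off-diagonal entry `d`. -/
def hermitianForm (a b d : ℝ) (η ζ : ℂ) : ℝ :=
  a * ‖η‖ ^ 2 + b * ‖ζ‖ ^ 2 + 2 * d * (η * conj ζ).re

lemma hermitianForm_sub (a b d a' b' d' : ℝ) (η ζ : ℂ) :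
    hermitianForm (a - a') (b - b') (d - d') η ζ
      = hermitianForm a b d η ζ - hermitianForm a' b' d' η ζ := by
  simp only [hermitianForm]
  ring

lemma hermitianForm_nonneg {a b d : ℝ} (ha : 0 ≤ a) (hb : 0 ≤ b) (hd : d ^ 2 ≤ a * b)
    (η ζ : ℂ) : 0 ≤ hermitianForm a b d η ζ := by
  have hd' : |d| ≤ √a * √b := by
    rw [← Real.sqrt_mul ha]
    exact Real.abs_le_sqrt hd
  have hre : |(η * conj ζ).re| ≤ ‖η‖ * ‖ζ‖ := by
    simpa using Complex.abs_re_le_norm (η * conj ζ)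
  have hcross : -(d * (η * conj ζ).re) ≤ √a * √b * (‖η‖ * ‖ζ‖) :=
    (neg_le_abs _).trans <| by
      rw [abs_mul]
      gcongr
  calc 0 ≤ (√a * ‖η‖ - √b * ‖ζ‖) ^ 2 := sq_nonneg _
    _ = √a ^ 2 * ‖η‖ ^ 2 + √b ^ 2 * ‖ζ‖ ^ 2 - 2 * (√a * √b * (‖η‖ * ‖ζ‖)) := by ring
    _ ≤ hermitianForm a b d η ζ := by
        rw [Real.sq_sqrt ha, Real.sq_sqrt hb, hermitianForm]
        linarith

lemma hermitianForm_rankOne (r t : ℝ) (η ζ : ℂ) :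
    hermitianForm (r ^ 2) (t ^ 2) (r * t) η ζ = ‖r * η + t * ζ‖ ^ 2 := by
  simp only [hermitianForm, Complex.sq_norm, normSq_apply, mul_re, mul_im, add_re, add_im,
    conj_re, conj_im, ofReal_re, ofReal_im]
  ring

/-- The smaller eigenvalue of the real symmetric matrix with diagonal `a`, `b` and off-diagonal
entry `d`. -/
def minEigenvalue (a b d : ℝ) : ℝ := (a + b - √((a + b) ^ 2 - 4 * (a * b - d ^ 2))) / 2

lemma minEigenvalue_mul_le_hermitianForm (a b d : ℝ) (η ζ : ℂ) :
    minEigenvalue a b d * (‖η‖ ^ 2 + ‖ζ‖ ^ 2) ≤ hermitianForm a b d η ζ := by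
  have hdisc : (a + b) ^ 2 - 4 * (a * b - d ^ 2) = (a - b) ^ 2 + 4 * d ^ 2 := by ring
  set r := √((a + b) ^ 2 - 4 * (a * b - d ^ 2)) with hr
  have hsq : r ^ 2 = (a - b) ^ 2 + 4 * d ^ 2 := by
    rw [hr, hdisc, Real.sq_sqrt (by positivity)]
  have habs : |a - b| ≤ r := Real.abs_le_sqrt (by rw [hdisc]; linarith [sq_nonneg d])
  have hnonneg :
      0 ≤ hermitianForm (a - minEigenvalue a b d) (b - minEigenvalue a b d) (d - 0) η ζ := by
    rw [minEigenvalue, ← hr]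
    apply hermitianForm_nonneg
    · linarith [neg_le_of_abs_le habs]
    · linarith [le_of_abs_le habs]
    · linarith
  rw [hermitianForm_sub] at hnonneg
  simp only [hermitianForm] at hnonneg ⊢
  linarith

lemma one_add_mul_pos_of_lt {μ a y : ℝ} (hμ : 0 < μ) (h : μ < 2 * y + a * y ^ 2) :
    0 < 1 + μ * a := by
  rcases le_or_gt 0 a with ha | ha
  · positivity
  · have : a * (2 * y + a * y ^ 2) < a * μ := mul_lt_mul_of_neg_left h ha
    linarith [sq_nonneg (a * y + 1)]

lemma div_one_add_sqrt_le {μ a y : ℝ} (hμ : 0 < μ) (hy : 0 < y) (h : μ < 2 * y + a * y ^ 2) :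
    μ / (1 + √(1 + μ * a)) ≤ y := by
  set r := √(1 + μ * a)
  have hr0 : 0 ≤ r := Real.sqrt_nonneg _
  have hr2 : r ^ 2 = 1 + μ * a := Real.sq_sqrt (one_add_mul_pos_of_lt hμ h).le
  have hfactor : (μ - y * (1 + r)) * (μ - y * (1 - r)) = μ * (μ - (2 * y + a * y ^ 2)) := by
    linear_combination (-y ^ 2) * hr2
  rw [div_le_iff₀ (by positivity)]
  by_contra! hlt
  have hneg : μ * (μ - (2 * y + a * y ^ 2)) < 0 := mul_neg_of_pos_of_neg hμ (sub_neg.2 h)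
  have hpos : 0 < (μ - y * (1 + r)) * (μ - y * (1 - r)) :=
    mul_pos (by linarith) (by nlinarith)
  linarith

/-- `2 y` is the ratio of shear to wave energy, in the mean square. -/
lemma exists_shear_ratio {μ J α Ep E g : ℝ} (hμ : 0 < μ) (hEp : 0 ≤ Ep) (hE : Ep < E) (hg : 0 ≤ g)
    (h : ∀ t > 0, μ * E + J * g ≤ (t * Ep + g / t) / 2 + α / 4 * g) :
    ∃ y > 0, g = 4 * y ^ 2 * E ∧ μ < 2 * y + (α - 4 * J) * y ^ 2 := by
  have hE0 : 0 < E := hEp.trans_lt hE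
  have hg' : g ≠ 0 := by
    rintro rfl
    have hbound := h μ hμ
    simp only [mul_zero, zero_div, add_zero] at hbound
    nlinarith [mul_pos hμ hE0, mul_lt_mul_of_pos_left hE hμ]
  have hratio : 0 < g / E := div_pos (hg.lt_of_ne' hg') hE0
  set y := √(g / E) / 2 with hy
  have hy0 : 0 < y := half_pos (Real.sqrt_pos.2 hratio)
  have hgy : g = 4 * y ^ 2 * E := by
    rw [hy, div_pow, Real.sq_sqrt hratio.le]
    field_simp
    norm_num
  refine ⟨y, hy0, hgy, lt_of_mul_lt_mul_right ?_ hE0.le⟩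
  have hgt : g / (2 * y) = 2 * y * E := by
    rw [hgy]
    field_simp
    norm_num
  have hbound := h (2 * y) (by positivity)
  rw [hgt, hgy] at hbound
  have : y * Ep < y * E := mul_lt_mul_of_pos_left hE hy0
  linarith

lemma radicand_pos_of_energy_le {μ J α Ep E g : ℝ} (hμ : 0 < μ) (hEp : 0 ≤ Ep) (hE : Ep < E)
    (hg : 0 ≤ g) (h : ∀ t > 0, μ * E + J * g ≤ (t * Ep + g / t) / 2 + α / 4 * g) :
    0 < 1 + μ * (α - 4 * J) := by
  obtain ⟨y, -, -, hy⟩ := exists_shear_ratio hμ hEp hE hg h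
  exact one_add_mul_pos_of_lt hμ hy

lemma mul_le_shear_of_energy_le {μ J α Ep E g : ℝ} (hμ : 0 < μ) (hEp : 0 ≤ Ep) (hE : Ep < E)
    (hg : 0 ≤ g) (h : ∀ t > 0, μ * E + J * g ≤ (t * Ep + g / t) / 2 + α / 4 * g) :
    4 * μ ^ 2 * ((1 + √(1 + μ * (α - 4 * J))) ^ 2)⁻¹ * E ≤ g := by
  obtain ⟨y, hy0, hgy, hy⟩ := exists_shear_ratio hμ hEp hE hg h
  have hsq := pow_le_pow_left₀ (by positivity) (div_one_add_sqrt_le hμ hy0 hy) 2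
  have hE0 : 0 ≤ E := hEp.trans hE.le
  calc 4 * μ ^ 2 * ((1 + √(1 + μ * (α - 4 * J))) ^ 2)⁻¹ * E
      = 4 * (μ / (1 + √(1 + μ * (α - 4 * J)))) ^ 2 * E := by
        rw [div_pow]
        ring
    _ ≤ 4 * y ^ 2 * E := by gcongr
    _ = g := hgy.symm

lemma lt_larger_root {a b d X : ℝ} (ha : 0 < a) (h : a * X ^ 2 - b * X + d < 0) :
    X < (b + √(b ^ 2 - 4 * a * d)) / (2 * a) := by
  have : 2 * a * X - b < √(b ^ 2 - 4 * a * d) := by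
    apply Real.lt_sqrt_of_sq_lt
    nlinarith
  rw [lt_div_iff₀ (by positivity)]
  linarith

/-! ### The displacement of a normal mode -/

section Derivatives

variable {E : Type*} [NormedAddCommGroup E] [NormedSpace ℝ E] {x : E}

lemma fderiv_comp_real_apply {φ : ℝ → ℂ} {f : E → ℝ} (hφ : DifferentiableAt ℝ φ (f x))
    (hf : DifferentiableAt ℝ f x) (v : E) :
    fderiv ℝ (fun y => φ (f y)) x v = deriv φ (f x) * (fderiv ℝ f x v : ℝ) := by
  have h := (hφ.hasDerivAt.hasFDerivAt.comp x hf.hasFDerivAt).fderiv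
  rw [show (fun y => φ (f y)) = φ ∘ f from rfl, h]
  simp [mul_comm]

lemma fderiv_ofReal_apply {f : E → ℝ} (hf : DifferentiableAt ℝ f x) (v : E) :
    fderiv ℝ (fun y => (f y : ℂ)) x v = (fderiv ℝ f x v : ℝ) := by
  simpa [(ofRealCLM.hasDerivAt (x := f x)).deriv] using
    fderiv_comp_real_apply (φ := ofRealCLM) ofRealCLM.differentiableAt hf v

lemma fderiv_conj_apply (f : E → ℂ) (v : E) :
    fderiv ℝ (fun y => conj (f y)) x v = conj (fderiv ℝ f x v) := by
  have h := fderiv_star (𝕜 := ℝ) (f := f) (x := x)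
  rw [show (fun y => conj (f y)) = fun y => star (f y) from rfl, h]
  simp

lemma fderiv_mul_fderiv_comm {q ρ G : E → ℝ} (hG : ContDiffAt ℝ 2 G x)
    (hρ : DifferentiableAt ℝ ρ x) (hq : ∀ᶠ y in 𝓝 x, HasFDerivAt q (ρ y • fderiv ℝ G y) y)
    (v v' : E) : fderiv ℝ G x v * fderiv ℝ ρ x v' = fderiv ℝ G x v' * fderiv ℝ ρ x v := by
  have hG' : DifferentiableAt ℝ (fderiv ℝ G) x :=
    (hG.fderiv_right (m := 1) (by norm_num)).differentiableAt one_ne_zero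
  have hGsymm := hG.isSymmSndFDerivAt (by simp) v v'
  have hqsymm := second_derivative_symmetric_of_eventually_of_real hq
    (hρ.hasFDerivAt.smul hG'.hasFDerivAt) v v'
  simp only [_root_.add_apply, _root_.smul_apply, smul_eq_mul,
    ContinuousLinearMap.smulRight_apply, hGsymm] at hqsymm
  linarith

lemma dy_add_dz_const_mul_mul {x : ℝ × ℝ} {f η ζ F H : ℝ × ℝ → ℂ} {κ : ℂ}
    (hf : DifferentiableAt ℝ f x) (hη : DifferentiableAt ℝ η x) (hζ : DifferentiableAt ℝ ζ x)
    (hF : F =ᶠ[𝓝 x] fun y => κ * (f y * η y)) (hH : H =ᶠ[𝓝 x] fun y => κ * (f y * ζ y)) :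
    dy F x + dz H x
      = κ * (η x * dy f x + ζ x * dz f x + f x * (dy η x + dz ζ x)) := by
  simp only [dy, dz, hF.fderiv_eq, hH.fderiv_eq, fderiv_const_mul (hf.fun_mul hη),
    fderiv_const_mul (hf.fun_mul hζ), fderiv_fun_mul hf hη, fderiv_fun_mul hf hζ,
    _root_.add_apply, _root_.smul_apply, smul_eq_mul]
  ring

end Derivatives

lemma shifted_re (S : BaseState) (c : ℂ) (x : ℝ × ℝ) : (shifted S c x).re = S.u x - c.re := by
  simp [shifted]

lemma shifted_im (S : BaseState) (c : ℂ) (x : ℝ × ℝ) : (shifted S c x).im = -c.im := by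
  simp [shifted]

lemma shifted_ne_zero (S : BaseState) {c : ℂ} (hc : c.im ≠ 0) (x : ℝ × ℝ) :
    shifted S c x ≠ 0 := by
  intro h
  have him := shifted_im S c x
  rw [h, zero_im, zero_eq_neg] at him
  exact hc him

lemma abs_im_le_norm_shifted (S : BaseState) (c : ℂ) (x : ℝ × ℝ) : |c.im| ≤ ‖shifted S c x‖ := by
  simpa [shifted_im] using Complex.abs_im_le_norm (shifted S c x)

lemma im_sq_le_norm_sq_sub_shifted_sq (S : BaseState) (c : ℂ) (x : ℝ × ℝ) :
    c.im ^ 2 ≤ ‖(S.s x : ℂ) ^ 2 - shifted S c x ^ 2‖ := by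
  rw [sq_sub_sq, norm_mul, ← sq_abs, sq]
  gcongr
  · simpa [shifted_im] using Complex.abs_im_le_norm (S.s x + shifted S c x)
  · simpa [shifted_im] using Complex.abs_im_le_norm (S.s x - shifted S c x)

lemma sq_sub_shifted_sq_ne_zero (S : BaseState) {c : ℂ} (hc : c.im ≠ 0) (x : ℝ × ℝ) :
    (S.s x : ℂ) ^ 2 - shifted S c x ^ 2 ≠ 0 :=
  norm_pos_iff.1 ((by positivity : 0 < c.im ^ 2).trans_le (im_sq_le_norm_sq_sub_shifted_sq S c x))

lemma CrossSection.IsBoundedC1.differentiableAt {R : CrossSection} {f : ℝ × ℝ → ℝ}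
    (hf : R.IsBoundedC1 f) {x : ℝ × ℝ} (hx : x ∈ R.D) : DifferentiableAt ℝ f x :=
  (hf.1.differentiableOn one_ne_zero).differentiableAt (R.isOpen_D.mem_nhds hx)

namespace BaseState.IsAdmissible

variable {R : CrossSection} {S : BaseState} {x : ℝ × ℝ}

lemma density_pos (hS : S.IsAdmissible R) (hx : x ∈ R.D) : 0 < S.ρ x := by
  obtain ⟨ε, hε, h⟩ := hS.ρ_pos
  exact hε.trans_le (h x hx)

lemma pressure_pos (hS : S.IsAdmissible R) (hx : x ∈ R.D) : 0 < S.p x := by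
  obtain ⟨ε, hε, h⟩ := hS.p_pos
  exact hε.trans_le (h x hx)

lemma s_sq (hS : S.IsAdmissible R) (hx : x ∈ R.D) : S.s x ^ 2 = S.γ * S.p x / S.ρ x :=
  Real.sq_sqrt (div_pos (mul_pos hS.γ_pos (hS.pressure_pos hx)) (hS.density_pos hx)).le

lemma s_sq_pos (hS : S.IsAdmissible R) (hx : x ∈ R.D) : 0 < S.s x ^ 2 := by
  rw [hS.s_sq hx]
  exact div_pos (mul_pos hS.γ_pos (hS.pressure_pos hx)) (hS.density_pos hx)

lemma a_sq (hS : S.IsAdmissible R) (hx : x ∈ R.D) :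
    S.a x ^ 2 = S.B x ^ 2 / (S.μ₀ * S.ρ x) := by
  rw [BaseState.a, div_pow, Real.sq_sqrt (mul_pos hS.μ₀_pos (hS.density_pos hx)).le]

lemma density_mul_a_sq (hS : S.IsAdmissible R) (hx : x ∈ R.D) :
    (S.ρ x : ℂ) * (S.a x : ℂ) ^ 2 = (S.B x : ℂ) ^ 2 / S.μ₀ := by
  have hρ := (hS.density_pos hx).ne'
  have hμ₀ := hS.μ₀_pos.ne'
  have : S.ρ x * S.a x ^ 2 = S.B x ^ 2 / S.μ₀ := by
    rw [hS.a_sq hx]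
    field_simp
  exact_mod_cast this

/-- The curl of `∇q = ρ ∇G`. -/
lemma dz_G_mul_dy_density (hS : S.IsAdmissible R) (hx : x ∈ R.D) :
    dz S.G x * dy S.ρ x = dy S.G x * dz S.ρ x := by
  have hn := R.isOpen_D.mem_nhds hx
  refine fderiv_mul_fderiv_comm (q := S.q) (hS.G_reg.contDiffAt hn)
    (hS.ρ_reg.differentiableAt hx) ?_ (0, 1) (1, 0)
  filter_upwards [hn] with y hy
  have hgrad : S.ρ y • fderiv ℝ S.G y = fderiv ℝ S.q y := by
    ext
    · simpa [dy] using (sub_eq_zero.1 (hS.magnetostatic_y y hy)).symm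
    · simpa [dz] using (sub_eq_zero.1 (hS.magnetostatic_z y hy)).symm
  rw [hgrad]
  exact (hS.q_reg.differentiableAt hy).hasFDerivAt

lemma contDiffOn_shifted (hS : S.IsAdmissible R) (c : ℂ) : ContDiffOn ℝ 1 (shifted S c) R.D :=
  (ofRealCLM.contDiff.comp_contDiffOn hS.u_reg.1).sub contDiffOn_const

lemma fderiv_shifted_apply (hS : S.IsAdmissible R) (c : ℂ) (hx : x ∈ R.D) (v : ℝ × ℝ) :
    fderiv ℝ (shifted S c) x v = (fderiv ℝ S.u x v : ℝ) := by
  rw [show shifted S c = fun y => (S.u y : ℂ) - c from rfl, fderiv_sub_const,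
    fderiv_ofReal_apply (hS.u_reg.differentiableAt hx)]

end BaseState.IsAdmissible

namespace Perturbation

variable (w : Perturbation) (S : BaseState) (k : ℝ) (c : ℂ)

/-- The divergence `η_y + ζ_z` of the displacement. -/
def divergence (x : ℝ × ℝ) : ℂ := dy (w.η S k c) x + dz (w.ζ S k c) x

/-- The increment `η f_y + ζ f_z` of a base field `f` under the displacement. -/
def increment (f : ℝ × ℝ → ℝ) (x : ℝ × ℝ) : ℂ := w.η S k c x * dy f x + w.ζ S k c x * dz f x

/-- The compression `P = (s² (η_y + ζ_z) + η G_y + ζ G_z) / (s² - U²)`, which is the divergence of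
the displacement in all three directions. -/
def compression (x : ℝ × ℝ) : ℂ :=
  ((S.s x : ℂ) ^ 2 * w.divergence S k c x + w.increment S k c S.G x)
    / ((S.s x : ℂ) ^ 2 - shifted S c x ^ 2)

end Perturbation

section Mode

variable {R : CrossSection} {S : BaseState} {k : ℝ} {c : ℂ} {w : Perturbation} {x : ℝ × ℝ}

lemma contDiffOn_div_shifted (hS : S.IsAdmissible R) (hk : k ≠ 0) (hc : c.im ≠ 0)
    {v : ℝ × ℝ → ℂ} (hv : ContDiffOn ℝ 1 v R.D) :
    ContDiffOn ℝ 1 (fun x => v x / (I * k * shifted S c x)) R.D := by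
  simp only [div_eq_mul_inv]
  refine hv.mul ((contDiffOn_const.mul (hS.contDiffOn_shifted c)).inv fun x _ => ?_)
  simp [hk, shifted_ne_zero S hc x]

lemma mul_shifted_mul_div (S : BaseState) (hk : k ≠ 0) (hc : c.im ≠ 0) (v : ℂ) (x : ℝ × ℝ) :
    I * k * (shifted S c x * (v / (I * k * shifted S c x))) = v := by
  have hU := shifted_ne_zero S hc x
  have hk' : (k : ℂ) ≠ 0 := by exact_mod_cast hk
  field_simp [I_ne_zero]

lemma Perturbation.vy_eq (S : BaseState) (hk : k ≠ 0) (hc : c.im ≠ 0) (x : ℝ × ℝ) :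
    w.vy x = I * k * (shifted S c x * w.η S k c x) :=
  (mul_shifted_mul_div S hk hc _ x).symm

lemma Perturbation.vz_eq (S : BaseState) (hk : k ≠ 0) (hc : c.im ≠ 0) (x : ℝ × ℝ) :
    w.vz x = I * k * (shifted S c x * w.ζ S k c x) :=
  (mul_shifted_mul_div S hk hc _ x).symm

lemma Perturbation.sq_sub_shifted_sq_mul_compression (S : BaseState) (hc : c.im ≠ 0)
    (x : ℝ × ℝ) :
    ((S.s x : ℂ) ^ 2 - shifted S c x ^ 2) * w.compression S k c x
      = (S.s x : ℂ) ^ 2 * w.divergence S k c x + w.increment S k c S.G x :=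
  mul_div_cancel₀ _ (sq_sub_shifted_sq_ne_zero S hc x)

namespace IsNormalMode

lemma contDiffOn_η (hw : IsNormalMode R S k c w) (hS : S.IsAdmissible R) (hk : k ≠ 0)
    (hc : c.im ≠ 0) : ContDiffOn ℝ 1 (w.η S k c) R.D :=
  contDiffOn_div_shifted hS hk hc hw.vy_reg

lemma contDiffOn_ζ (hw : IsNormalMode R S k c w) (hS : S.IsAdmissible R) (hk : k ≠ 0)
    (hc : c.im ≠ 0) : ContDiffOn ℝ 1 (w.ζ S k c) R.D :=
  contDiffOn_div_shifted hS hk hc hw.vz_reg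

lemma bY_eq (hw : IsNormalMode R S k c w) (hk : k ≠ 0) (hc : c.im ≠ 0) (hx : x ∈ R.D) :
    w.bY x = I * k * (S.B x * w.η S k c x) := by
  have hinduction := (hw.solves x hx).induction_y
  rw [w.vy_eq S hk hc] at hinduction
  have hUk : shifted S c x * (I * k) ≠ 0 := by simp [hk, shifted_ne_zero S hc x]
  apply mul_left_cancel₀ hUk
  linear_combination hinduction

lemma bz_eq (hw : IsNormalMode R S k c w) (hk : k ≠ 0) (hc : c.im ≠ 0) (hx : x ∈ R.D) :
    w.bz x = I * k * (S.B x * w.ζ S k c x) := by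
  have hinduction := (hw.solves x hx).induction_z
  rw [w.vz_eq S hk hc] at hinduction
  have hUk : shifted S c x * (I * k) ≠ 0 := by simp [hk, shifted_ne_zero S hc x]
  apply mul_left_cancel₀ hUk
  linear_combination hinduction

lemma dy_vy_add_dz_vz (hw : IsNormalMode R S k c w) (hS : S.IsAdmissible R) (hk : k ≠ 0)
    (hc : c.im ≠ 0) (hx : x ∈ R.D) :
    dy w.vy x + dz w.vz x
      = I * k * (w.increment S k c S.u x + shifted S c x * w.divergence S k c x) := by
  have hn := R.isOpen_D.mem_nhds hx
  rw [dy_add_dz_const_mul_mul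
    (((hS.contDiffOn_shifted c).contDiffAt hn).differentiableAt one_ne_zero)
    (((hw.contDiffOn_η hS hk hc).contDiffAt hn).differentiableAt one_ne_zero)
    (((hw.contDiffOn_ζ hS hk hc).contDiffAt hn).differentiableAt one_ne_zero)
    (.of_forall (w.vy_eq S hk hc)) (.of_forall (w.vz_eq S hk hc))]
  simp only [dy, dz, hS.fderiv_shifted_apply c hx, Perturbation.increment,
    Perturbation.divergence]

lemma dy_bY_add_dz_bz (hw : IsNormalMode R S k c w) (hS : S.IsAdmissible R) (hk : k ≠ 0)
    (hc : c.im ≠ 0) (hx : x ∈ R.D) :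
    dy w.bY x + dz w.bz x
      = I * k * (w.increment S k c S.B x + S.B x * w.divergence S k c x) := by
  have hn := R.isOpen_D.mem_nhds hx
  have hB := hS.B_reg.differentiableAt hx
  rw [dy_add_dz_const_mul_mul (f := fun y => (S.B y : ℂ)) (ofRealCLM.differentiableAt.comp x hB)
    (((hw.contDiffOn_η hS hk hc).contDiffAt hn).differentiableAt one_ne_zero)
    (((hw.contDiffOn_ζ hS hk hc).contDiffAt hn).differentiableAt one_ne_zero)
    (eventually_of_mem hn fun _ => hw.bY_eq hk hc) (eventually_of_mem hn fun _ => hw.bz_eq hk hc)]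
  simp only [dy, dz, fderiv_ofReal_apply hB, Perturbation.increment, Perturbation.divergence]

lemma bx_eq (hw : IsNormalMode R S k c w) (hS : S.IsAdmissible R) (hk : k ≠ 0)
    (hc : c.im ≠ 0) (hx : x ∈ R.D) :
    w.bx x = -(w.increment S k c S.B x + S.B x * w.divergence S k c x) := by
  have hgauss := (hw.solves x hx).gauss
  rw [add_assoc, hw.dy_bY_add_dz_bz hS hk hc hx] at hgauss
  have hIk : I * (k : ℂ) ≠ 0 := by simp [hk]
  apply mul_left_cancel₀ hIk
  linear_combination hgauss

lemma q_eq_of_vx (hw : IsNormalMode R S k c w) (hS : S.IsAdmissible R) (hk : k ≠ 0)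
    (hc : c.im ≠ 0) (hx : x ∈ R.D) :
    w.q x = -S.ρ x * (shifted S c x * (w.vx x + w.increment S k c S.u x)
      + (S.a x : ℂ) ^ 2 * w.divergence S k c x) := by
  have hmomentum := (hw.solves x hx).momentum_x
  rw [hw.bx_eq hS hk hc hx, hw.bY_eq hk hc hx, hw.bz_eq hk hc hx, w.vy_eq S hk hc,
    w.vz_eq S hk hc] at hmomentum
  have hIk : I * (k : ℂ) ≠ 0 := by simp [hk]
  have ha := hS.density_mul_a_sq hx
  apply mul_left_cancel₀ hIk
  simp only [Perturbation.increment] at hmomentum ⊢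
  linear_combination hmomentum + I * k * w.divergence S k c x * ha

lemma shifted_mul_density (hw : IsNormalMode R S k c w) (hS : S.IsAdmissible R) (hk : k ≠ 0)
    (hc : c.im ≠ 0) (hx : x ∈ R.D) :
    shifted S c x * w.ρ x = -(shifted S c x * w.increment S k c S.ρ x)
      - S.ρ x * (w.vx x + w.increment S k c S.u x + shifted S c x * w.divergence S k c x) := by
  have hmass := (hw.solves x hx).mass
  rw [add_assoc (I * (k : ℂ) * w.vx x), hw.dy_vy_add_dz_vz hS hk hc hx, w.vy_eq S hk hc,
    w.vz_eq S hk hc] at hmass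
  have hIk : I * (k : ℂ) ≠ 0 := by simp [hk]
  apply mul_left_cancel₀ hIk
  simp only [Perturbation.increment] at hmass ⊢
  linear_combination hmass

lemma vx_eq (hw : IsNormalMode R S k c w) (hS : S.IsAdmissible R) (hk : k ≠ 0)
    (hc : c.im ≠ 0) (hx : x ∈ R.D) :
    w.vx x = -w.increment S k c S.u x - shifted S c x * w.compression S k c x := by
  have henergy := (hw.solves x hx).energy
  rw [hw.bx_eq hS hk hc hx, hw.q_eq_of_vx hS hk hc hx, w.vy_eq S hk hc, w.vz_eq S hk hc]
    at henergy
  have hmass := hw.shifted_mul_density hS hk hc hx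
  have hcompression := w.sq_sub_shifted_sq_mul_compression (k := k) S hc x
  have ha := hS.density_mul_a_sq hx
  have hne : I * k * (S.ρ x * ((S.s x : ℂ) ^ 2 - shifted S c x ^ 2)) ≠ 0 := by
    simp [hk, (hS.density_pos hx).ne', sq_sub_shifted_sq_ne_zero S hc x]
  apply mul_left_cancel₀ hne
  simp only [Perturbation.increment] at henergy hmass hcompression ⊢
  linear_combination -henergy + I * k * (S.s x : ℂ) ^ 2 * hmass
    + I * k * S.ρ x * shifted S c x * hcompression
    + I * k * shifted S c x * w.divergence S k c x * ha

lemma q_eq (hw : IsNormalMode R S k c w) (hS : S.IsAdmissible R) (hk : k ≠ 0)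
    (hc : c.im ≠ 0) (hx : x ∈ R.D) :
    w.q x = S.ρ x * (shifted S c x ^ 2 * w.compression S k c x
      - (S.a x : ℂ) ^ 2 * w.divergence S k c x) := by
  rw [hw.q_eq_of_vx hS hk hc hx, hw.vx_eq hS hk hc hx]
  ring

lemma density_eq (hw : IsNormalMode R S k c w) (hS : S.IsAdmissible R) (hk : k ≠ 0)
    (hc : c.im ≠ 0) (hx : x ∈ R.D) :
    w.ρ x = S.ρ x * (w.compression S k c x - w.divergence S k c x)
      - w.increment S k c S.ρ x := by
  have hmass := hw.shifted_mul_density hS hk hc hx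
  rw [hw.vx_eq hS hk hc hx] at hmass
  apply mul_left_cancel₀ (shifted_ne_zero S hc x)
  linear_combination hmass

lemma dy_q_eq (hw : IsNormalMode R S k c w) (hS : S.IsAdmissible R) (hk : k ≠ 0)
    (hc : c.im ≠ 0) (hx : x ∈ R.D) :
    dy w.q x = k ^ 2 * S.ρ x * (shifted S c x ^ 2 - (S.a x : ℂ) ^ 2) * w.η S k c x
      + dy S.G x * w.ρ x := by
  have hmomentum := (hw.solves x hx).momentum_y
  rw [hw.bY_eq hk hc hx, w.vy_eq S hk hc] at hmomentum
  have ha := hS.density_mul_a_sq hx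
  linear_combination hmomentum + k ^ 2 * w.η S k c x * ha
    - k ^ 2 * w.η S k c x * (S.ρ x * shifted S c x ^ 2 - S.B x ^ 2 / S.μ₀) * I_sq

lemma dz_q_eq (hw : IsNormalMode R S k c w) (hS : S.IsAdmissible R) (hk : k ≠ 0)
    (hc : c.im ≠ 0) (hx : x ∈ R.D) :
    dz w.q x = k ^ 2 * S.ρ x * (shifted S c x ^ 2 - (S.a x : ℂ) ^ 2) * w.ζ S k c x
      + dz S.G x * w.ρ x := by
  have hmomentum := (hw.solves x hx).momentum_z
  rw [hw.bz_eq hk hc hx, w.vz_eq S hk hc] at hmomentum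
  have ha := hS.density_mul_a_sq hx
  linear_combination hmomentum + k ^ 2 * w.ζ S k c x * ha
    - k ^ 2 * w.ζ S k c x * (S.ρ x * shifted S c x ^ 2 - S.B x ^ 2 / S.μ₀) * I_sq

end IsNormalMode

end Mode

/-! ### Bounded continuous coefficients -/

/-- A field that is continuous and bounded on `s`; these are the coefficients that multiply the
square integrable amplitudes of a mode. -/
def BddContinuousOn {X E : Type*} [TopologicalSpace X] [NormedAddCommGroup E] (f : X → E)
    (s : Set X) : Prop :=
  ContinuousOn f s ∧ ∃ C : ℝ, ∀ x ∈ s, ‖f x‖ ≤ C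

namespace BddContinuousOn

section Algebra

variable {X : Type*} [TopologicalSpace X] {s : Set X} {E : Type*} [NormedAddCommGroup E]
  {A : Type*} [NormedRing A] {𝕜 : Type*} [NormedField 𝕜]

lemma const (e : E) : BddContinuousOn (fun _ => e) s :=
  ⟨continuousOn_const, ‖e‖, fun _ _ => le_rfl⟩

lemma congr {f g : X → E} (hf : BddContinuousOn f s) (h : EqOn g f s) : BddContinuousOn g s := by
  obtain ⟨C, hC⟩ := hf.2
  exact ⟨hf.1.congr h, C, fun x hx => (congrArg norm (h hx)).trans_le (hC x hx)⟩

lemma add {f g : X → E} (hf : BddContinuousOn f s) (hg : BddContinuousOn g s) :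
    BddContinuousOn (fun x => f x + g x) s := by
  obtain ⟨C, hC⟩ := hf.2
  obtain ⟨C', hC'⟩ := hg.2
  exact ⟨hf.1.add hg.1, C + C', fun x hx => norm_add_le_of_le (hC x hx) (hC' x hx)⟩

lemma sub {f g : X → E} (hf : BddContinuousOn f s) (hg : BddContinuousOn g s) :
    BddContinuousOn (fun x => f x - g x) s := by
  obtain ⟨C, hC⟩ := hf.2
  obtain ⟨C', hC'⟩ := hg.2
  exact ⟨hf.1.sub hg.1, C + C', fun x hx => norm_sub_le_of_le (hC x hx) (hC' x hx)⟩

lemma mul {f g : X → A} (hf : BddContinuousOn f s) (hg : BddContinuousOn g s) :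
    BddContinuousOn (fun x => f x * g x) s := by
  obtain ⟨C, hC⟩ := hf.2
  obtain ⟨C', hC'⟩ := hg.2
  exact ⟨hf.1.mul hg.1, C * C', fun x hx => norm_mul_le_of_le (hC x hx) (hC' x hx)⟩

lemma pow {f : X → A} (hf : BddContinuousOn f s) (n : ℕ) :
    BddContinuousOn (fun x => f x ^ n) s := by
  induction n with
  | zero => simpa only [pow_zero] using const 1
  | succ n ih => simpa only [pow_succ] using ih.mul hf

lemma inv {f : X → 𝕜} (hf : BddContinuousOn f s) {ε : ℝ} (hε : 0 < ε)
    (h : ∀ x ∈ s, ε ≤ ‖f x‖) : BddContinuousOn (fun x => (f x)⁻¹) s := by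
  refine ⟨hf.1.inv₀ fun x hx => norm_pos_iff.1 (hε.trans_le (h x hx)), ε⁻¹, fun x hx => ?_⟩
  rw [norm_inv]
  exact inv_anti₀ hε (h x hx)

lemma norm {f : X → E} (hf : BddContinuousOn f s) : BddContinuousOn (fun x => ‖f x‖) s := by
  obtain ⟨C, hC⟩ := hf.2
  exact ⟨hf.1.norm, C, fun x hx => (norm_norm _).trans_le (hC x hx)⟩

lemma comp {f : X → ℝ} (hf : BddContinuousOn f s) {φ : ℝ → E} (hφ : Continuous φ) :
    BddContinuousOn (fun x => φ (f x)) s := by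
  obtain ⟨C, hC⟩ := hf.2
  obtain ⟨M, hM⟩ := (isCompact_Icc (a := -C) (b := C)).exists_bound_of_continuousOn hφ.continuousOn
  exact ⟨hφ.comp_continuousOn hf.1, M, fun x hx => hM _ (abs_le.1 (hC x hx))⟩

lemma ofReal {f : X → ℝ} (hf : BddContinuousOn f s) : BddContinuousOn (fun x => (f x : ℂ)) s :=
  hf.comp continuous_ofReal

lemma bddAbove_image {f : X → ℝ} (hf : BddContinuousOn f s) : BddAbove (f '' s) := by
  obtain ⟨C, hC⟩ := hf.2
  exact ⟨C, forall_mem_image.2 fun x hx => (le_abs_self _).trans (hC x hx)⟩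

lemma bddBelow_image {f : X → ℝ} (hf : BddContinuousOn f s) : BddBelow (f '' s) := by
  obtain ⟨C, hC⟩ := hf.2
  exact ⟨-C, forall_mem_image.2 fun x hx => neg_le_of_abs_le (hC x hx)⟩

end Algebra

variable {X : Type*} [TopologicalSpace X] [SecondCountableTopology X] [MeasurableSpace X]
  [OpensMeasurableSpace X] {s : Set X} {μ : Measure X}

lemma memLp_top {E : Type*} [NormedAddCommGroup E] {f : X → E} (hf : BddContinuousOn f s)
    (hs : MeasurableSet s) (hμ : ∀ᵐ x ∂μ, x ∈ s) : MemLp f ⊤ μ := by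
  obtain ⟨C, hC⟩ := hf.2
  refine memLp_top_of_bound ?_ C (hμ.mono hC)
  rw [← Measure.restrict_eq_self_of_ae_mem hμ]
  exact hf.1.aestronglyMeasurable hs

lemma mul_memLp {A : Type*} [NormedRing A] {f g : X → A} (hf : BddContinuousOn f s)
    (hs : MeasurableSet s) (hμ : ∀ᵐ x ∂μ, x ∈ s) {p : ENNReal} (hg : MemLp g p μ) :
    MemLp (fun x => f x * g x) p μ :=
  hg.mul (hf.memLp_top hs hμ)

lemma mul_integrable {A : Type*} [NormedRing A] {f g : X → A} (hf : BddContinuousOn f s)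
    (hs : MeasurableSet s) (hμ : ∀ᵐ x ∂μ, x ∈ s) (hg : Integrable g μ) :
    Integrable (fun x => f x * g x) μ :=
  memLp_one_iff_integrable.1 (hf.mul_memLp hs hμ (memLp_one_iff_integrable.2 hg))

end BddContinuousOn

lemma continuousOn_fderiv_apply {E F : Type*} [NormedAddCommGroup E] [NormedSpace ℝ E]
    [NormedAddCommGroup F] [NormedSpace ℝ F] {f : E → F} {s : Set E} (hs : IsOpen s)
    (hf : ContDiffOn ℝ 1 f s) (v : E) : ContinuousOn (fun x => fderiv ℝ f x v) s :=
  (hf.continuousOn_fderiv_of_isOpen hs le_rfl).clm_apply continuousOn_const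

namespace CrossSection

variable {R : CrossSection}

lemma IsBoundedC1.bddContinuousOn {f : ℝ × ℝ → ℝ} (hf : R.IsBoundedC1 f) :
    BddContinuousOn f R.D := by
  obtain ⟨C, hC⟩ := hf.2
  exact ⟨hf.1.continuousOn, C, fun x hx => (hC x hx).1⟩

lemma IsBoundedC1.bddContinuousOn_dy {f : ℝ × ℝ → ℝ} (hf : R.IsBoundedC1 f) :
    BddContinuousOn (dy f) R.D := by
  obtain ⟨C, hC⟩ := hf.2
  exact ⟨continuousOn_fderiv_apply R.isOpen_D hf.1 (1, 0), C, fun x hx => (hC x hx).2.1⟩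

lemma IsBoundedC1.bddContinuousOn_dz {f : ℝ × ℝ → ℝ} (hf : R.IsBoundedC1 f) :
    BddContinuousOn (dz f) R.D := by
  obtain ⟨C, hC⟩ := hf.2
  exact ⟨continuousOn_fderiv_apply R.isOpen_D hf.1 (0, 1), C, fun x hx => (hC x hx).2.2⟩

end CrossSection

namespace BaseState.IsAdmissible

variable {R : CrossSection} {S : BaseState}

lemma bddContinuousOn_dy_G (hS : S.IsAdmissible R) : BddContinuousOn (dy S.G) R.D := by
  obtain ⟨C, hC⟩ := hS.G_bdd
  exact ⟨continuousOn_fderiv_apply R.isOpen_D (hS.G_reg.of_le one_le_two) (1, 0), C,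
    fun x hx => (hC x hx).1⟩

lemma bddContinuousOn_dz_G (hS : S.IsAdmissible R) : BddContinuousOn (dz S.G) R.D := by
  obtain ⟨C, hC⟩ := hS.G_bdd
  exact ⟨continuousOn_fderiv_apply R.isOpen_D (hS.G_reg.of_le one_le_two) (0, 1), C,
    fun x hx => (hC x hx).2⟩

lemma bddContinuousOn_inv_density (hS : S.IsAdmissible R) :
    BddContinuousOn (fun x => (S.ρ x)⁻¹) R.D := by
  obtain ⟨ε, hε, h⟩ := hS.ρ_pos
  exact hS.ρ_reg.bddContinuousOn.inv hε fun x hx => (h x hx).trans (le_abs_self _)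

lemma bddContinuousOn_pressure (hS : S.IsAdmissible R) : BddContinuousOn S.p R.D :=
  hS.q_reg.bddContinuousOn.sub <| ((hS.B_reg.bddContinuousOn.pow 2).mul (.const _)).congr
    fun _ _ => div_eq_mul_inv _ _

lemma bddContinuousOn_s_sq (hS : S.IsAdmissible R) : BddContinuousOn (fun x => S.s x ^ 2) R.D :=
  (((BddContinuousOn.const S.γ).mul hS.bddContinuousOn_pressure).mul
    hS.bddContinuousOn_inv_density).congr fun x hx => by
      simp only [hS.s_sq hx, div_eq_mul_inv]

lemma bddContinuousOn_inv_s_sq (hS : S.IsAdmissible R) :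
    BddContinuousOn (fun x => (S.s x ^ 2)⁻¹) R.D := by
  obtain ⟨ε, hε, h⟩ := hS.p_pos
  have hp : BddContinuousOn (fun x => (S.p x)⁻¹) R.D :=
    hS.bddContinuousOn_pressure.inv hε fun x hx => (h x hx).trans (le_abs_self _)
  refine ((hS.ρ_reg.bddContinuousOn.mul (.const S.γ⁻¹)).mul hp).congr fun x hx => ?_
  simp only [hS.s_sq hx]
  rw [inv_div, div_eq_mul_inv, mul_inv, mul_assoc]

lemma bddContinuousOn_a_sq (hS : S.IsAdmissible R) :
    BddContinuousOn (fun x => S.a x ^ 2) R.D :=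
  (((hS.B_reg.bddContinuousOn.pow 2).mul (.const S.μ₀⁻¹)).mul
    hS.bddContinuousOn_inv_density).congr fun x hx => by
      simp only [hS.a_sq hx, div_eq_mul_inv, mul_inv, mul_assoc]

lemma bddContinuousOn_N1sq (hS : S.IsAdmissible R) : BddContinuousOn S.N1sq R.D :=
  (((hS.bddContinuousOn_dy_G.mul hS.ρ_reg.bddContinuousOn_dy).mul
    hS.bddContinuousOn_inv_density).sub
    ((hS.bddContinuousOn_dy_G.pow 2).mul hS.bddContinuousOn_inv_s_sq)).congr fun x _ => by
      simp only [BaseState.N1sq, div_eq_mul_inv]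

lemma bddContinuousOn_N2sq (hS : S.IsAdmissible R) : BddContinuousOn S.N2sq R.D :=
  (((hS.bddContinuousOn_dz_G.mul hS.ρ_reg.bddContinuousOn_dz).mul
    hS.bddContinuousOn_inv_density).sub
    ((hS.bddContinuousOn_dz_G.pow 2).mul hS.bddContinuousOn_inv_s_sq)).congr fun x _ => by
      simp only [BaseState.N2sq, div_eq_mul_inv]

lemma bddContinuousOn_N12sq (hS : S.IsAdmissible R) : BddContinuousOn S.N12sq R.D :=
  (((hS.bddContinuousOn_dz_G.mul hS.ρ_reg.bddContinuousOn_dy).mul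
    hS.bddContinuousOn_inv_density).sub
    ((hS.bddContinuousOn_dy_G.mul hS.bddContinuousOn_dz_G).mul
      hS.bddContinuousOn_inv_s_sq)).congr fun x _ => by
      simp only [BaseState.N12sq, div_eq_mul_inv]

lemma bddContinuousOn_misalignment (hS : S.IsAdmissible R) :
    BddContinuousOn (S.misalignment R) R.D := by
  have hy := hS.u_reg.bddContinuousOn_dy
  have hz := hS.u_reg.bddContinuousOn_dz
  have htrace : BddContinuousOn (fun x => S.N1sq x + S.N2sq x - S.Jm R * S.shearSq x) R.D :=
    (hS.bddContinuousOn_N1sq.add hS.bddContinuousOn_N2sq).sub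
      ((BddContinuousOn.const _).mul ((hy.pow 2).add (hz.pow 2)))
  have hcross : BddContinuousOn (fun x => dz S.u x ^ 2 * S.N1sq x + dy S.u x ^ 2 * S.N2sq x
      - 2 * dy S.u x * dz S.u x * S.N12sq x) R.D :=
    (((hz.pow 2).mul hS.bddContinuousOn_N1sq).add ((hy.pow 2).mul hS.bddContinuousOn_N2sq)).sub
      ((((BddContinuousOn.const 2).mul hy).mul hz).mul hS.bddContinuousOn_N12sq)
  exact (((((htrace.pow 2).add ((BddContinuousOn.const (4 * S.Jm R)).mul hcross)).comp
    Real.continuous_sqrt).sub htrace).mul (.const (2 : ℝ)⁻¹)).congr fun _ _ => div_eq_mul_inv _ _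

lemma bddContinuousOn_shifted (hS : S.IsAdmissible R) (c : ℂ) :
    BddContinuousOn (shifted S c) R.D :=
  hS.u_reg.bddContinuousOn.ofReal.sub (.const c)

lemma bddContinuousOn_inertia (hS : S.IsAdmissible R) (k : ℝ) (c : ℂ) :
    BddContinuousOn (fun x => (k : ℂ) ^ 2 * S.ρ x * (shifted S c x ^ 2 - (S.a x : ℂ) ^ 2)) R.D :=
  ((BddContinuousOn.const _).mul hS.ρ_reg.bddContinuousOn.ofReal).mul
    (((hS.bddContinuousOn_shifted c).pow 2).sub
      (hS.bddContinuousOn_a_sq.ofReal.congr fun _ _ => (ofReal_pow _ _).symm))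

lemma bddContinuousOn_inv_norm_shifted (hS : S.IsAdmissible R) {c : ℂ} (hc : c.im ≠ 0) :
    BddContinuousOn (fun x => ‖shifted S c x‖⁻¹) R.D :=
  (hS.bddContinuousOn_shifted c).norm.inv (abs_pos.2 hc) fun x _ => by
    simpa only [norm_norm] using abs_im_le_norm_shifted S c x

lemma bddContinuousOn_inv_sq_sub_shifted_sq (hS : S.IsAdmissible R) {c : ℂ} (hc : c.im ≠ 0) :
    BddContinuousOn (fun x => ((S.s x : ℂ) ^ 2 - shifted S c x ^ 2)⁻¹) R.D := by
  have h : BddContinuousOn (fun x => (S.s x : ℂ) ^ 2 - shifted S c x ^ 2) R.D :=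
    (hS.bddContinuousOn_s_sq.ofReal.congr fun _ _ => (ofReal_pow _ _).symm).sub
      ((hS.bddContinuousOn_shifted c).pow 2)
  exact h.inv (by positivity : 0 < c.im ^ 2) fun x _ => im_sq_le_norm_sq_sub_shifted_sq S c x

lemma N1sq_mul_N2sq {x : ℝ × ℝ} (hS : S.IsAdmissible R) (hx : x ∈ R.D) :
    S.N1sq x * S.N2sq x = S.N12sq x ^ 2 := by
  have hN12 : S.N12sq x = dy S.G x * dz S.ρ x / S.ρ x - dy S.G x * dz S.G x / S.s x ^ 2 := by
    rw [BaseState.N12sq, hS.dz_G_mul_dy_density hx]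
  rw [sq]
  nth_rewrite 1 [hN12]
  simp only [BaseState.N1sq, BaseState.N2sq, BaseState.N12sq]
  ring

lemma N1sq_nonneg {x : ℝ × ℝ} (hS : S.IsAdmissible R) (hx : x ∈ R.D)
    (hN : 0 ≤ S.N1sq x + S.N2sq x) : 0 ≤ S.N1sq x := by
  have := hS.N1sq_mul_N2sq hx
  by_contra! h
  nlinarith [sq_nonneg (S.N12sq x)]

lemma N2sq_nonneg {x : ℝ × ℝ} (hS : S.IsAdmissible R) (hx : x ∈ R.D)
    (hN : 0 ≤ S.N1sq x + S.N2sq x) : 0 ≤ S.N2sq x := by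
  have := hS.N1sq_mul_N2sq hx
  by_contra! h
  nlinarith [sq_nonneg (S.N12sq x)]

lemma misalignment_eq_neg_minEigenvalue {x : ℝ × ℝ} (hS : S.IsAdmissible R) (hx : x ∈ R.D) :
    S.misalignment R x = -minEigenvalue (S.N1sq x - S.Jm R * dy S.u x ^ 2)
      (S.N2sq x - S.Jm R * dz S.u x ^ 2) (S.N12sq x - S.Jm R * (dy S.u x * dz S.u x)) := by
  have htrace : S.N1sq x + S.N2sq x - S.Jm R * S.shearSq x
      = S.N1sq x - S.Jm R * dy S.u x ^ 2 + (S.N2sq x - S.Jm R * dz S.u x ^ 2) := by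
    rw [BaseState.shearSq]
    ring
  rw [BaseState.misalignment, minEigenvalue, htrace, ← neg_div, neg_sub]
  congr 3
  linear_combination 4 * hS.N1sq_mul_N2sq hx

lemma misalignment_le {x : ℝ × ℝ} (hS : S.IsAdmissible R) (hx : x ∈ R.D) :
    S.misalignment R x ≤ S.lamM R :=
  le_csSup hS.bddContinuousOn_misalignment.bddAbove_image (mem_image_of_mem _ hx)

lemma a_sq_le {x : ℝ × ℝ} (hS : S.IsAdmissible R) (hx : x ∈ R.D) : S.a x ^ 2 ≤ S.aMsq R :=
  le_csSup hS.bddContinuousOn_a_sq.bddAbove_image (mem_image_of_mem (fun x => S.a x ^ 2) hx)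

lemma u_sub_uPlus_sq_le {x : ℝ × ℝ} (hS : S.IsAdmissible R) (hx : x ∈ R.D) :
    (S.u x - S.uPlus R) ^ 2 ≤ S.uMinus R ^ 2 := by
  have hu := hS.u_reg.bddContinuousOn
  have hle : S.u x ≤ sSup (S.u '' R.D) := le_csSup hu.bddAbove_image (mem_image_of_mem _ hx)
  have hge : sInf (S.u '' R.D) ≤ S.u x := csInf_le hu.bddBelow_image (mem_image_of_mem _ hx)
  rw [BaseState.uPlus, BaseState.uMinus]
  nlinarith

end BaseState.IsAdmissible

lemma BaseState.Jm_nonneg {R : CrossSection} {S : BaseState}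
    (hN : ∀ x ∈ R.D, 0 ≤ S.N1sq x + S.N2sq x) : 0 ≤ S.Jm R := by
  apply Real.sInf_nonneg
  rintro _ ⟨x, hx, rfl⟩
  exact div_nonneg (hN x hx.1) (add_nonneg (sq_nonneg _) (sq_nonneg _))

lemma BaseState.IsAdmissible.misalignment_nonneg {R : CrossSection} {S : BaseState} {x : ℝ × ℝ}
    (hS : S.IsAdmissible R) (hN : ∀ x ∈ R.D, 0 ≤ S.N1sq x + S.N2sq x) (hx : x ∈ R.D) :
    0 ≤ S.misalignment R x := by
  have hform := hermitianForm_nonneg (hS.N1sq_nonneg hx (hN x hx)) (hS.N2sq_nonneg hx (hN x hx))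
    (hS.N1sq_mul_N2sq hx).ge (dz S.u x : ℝ) (-(dy S.u x : ℝ))
  have hcross : hermitianForm (S.N1sq x) (S.N2sq x) (S.N12sq x) (dz S.u x : ℝ)
      (-(dy S.u x : ℝ))
      = dz S.u x ^ 2 * S.N1sq x + dy S.u x ^ 2 * S.N2sq x
        - 2 * dy S.u x * dz S.u x * S.N12sq x := by
    simp only [hermitianForm, norm_neg, norm_real, Real.norm_eq_abs, sq_abs, map_neg, conj_ofReal,
      mul_neg, ← ofReal_mul, neg_re, ofReal_re]
    ring
  rw [hcross] at hform
  rw [BaseState.misalignment]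
  have hsqrt := Real.le_sqrt_of_sq_le (le_add_of_nonneg_right
    (a := (S.N1sq x + S.N2sq x - S.Jm R * S.shearSq x) ^ 2)
    (mul_nonneg (mul_nonneg zero_le_four (BaseState.Jm_nonneg hN)) hform))
  linarith

lemma BaseState.Θ_le (S : BaseState) {R : CrossSection} (c : ℂ) {x : ℝ × ℝ} (hx : x ∈ R.D) :
    S.Θ R c ≤ min (S.a x ^ 2) (c.im ^ 4 / S.s x ^ 2) := by
  refine csInf_le ⟨0, forall_mem_image.2 fun y _ => le_min (sq_nonneg _) (by positivity)⟩
    (mem_image_of_mem (fun x => min (S.a x ^ 2) (c.im ^ 4 / S.s x ^ 2)) hx)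

/-! ### The mass measure -/

lemma CrossSection.ae_mem_D (R : CrossSection) : ∀ᵐ x ∂volume.restrict R.cell, x ∈ R.D :=
  ae_mono (Measure.restrict_mono R.cell_subset le_rfl) (ae_restrict_mem R.isOpen_D.measurableSet)

lemma CrossSection.ae_restrict_D_of_ae_restrict_cell (R : CrossSection) {P : ℝ × ℝ → Prop}
    (hP : ∀ l ∈ R.periods, ∀ x ∈ R.D, P (x + l) → P x)
    (h : ∀ᵐ x ∂volume.restrict R.cell, P x) : ∀ᵐ x ∂volume.restrict R.D, P x := by
  have := R.discrete_periods
  have : Countable R.periods := countable_of_Lindelof_of_discrete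
  have hbad : volume ({x | ¬P x} ∩ R.cell) = 0 :=
    le_antisymm ((Measure.le_restrict_apply _ _).trans (ae_iff.1 h).le) zero_le
  have htranslates :
      volume (⋃ g : R.periods, (fun x => (g : ℝ × ℝ) + x) ⁻¹' ({x | ¬P x} ∩ R.cell)) = 0 :=
    measure_iUnion_null fun g => by rw [measure_preimage_add, hbad]
  filter_upwards [ae_restrict_of_ae (measure_eq_zero_iff_ae_notMem.1 htranslates),
    R.isFundamentalDomain.ae_covers, ae_restrict_mem R.isOpen_D.measurableSet]
    with x hx ⟨g, hg⟩ hxD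
  by_contra hPx
  refine hx (mem_iUnion.2 ⟨g, fun hPg => hPx (hP g g.2 x hxD ?_), hg⟩)
  rwa [add_comm]

/-- The distribution of mass in one period of the cross-section. -/
def BaseState.massMeasure (S : BaseState) (R : CrossSection) : Measure (ℝ × ℝ) :=
  (volume.restrict R.cell).withDensity fun x => ENNReal.ofReal (S.ρ x)

lemma BaseState.ae_mem_D (S : BaseState) (R : CrossSection) : ∀ᵐ x ∂S.massMeasure R, x ∈ R.D :=
  (withDensity_absolutelyContinuous _ _).ae_le R.ae_mem_D

namespace BaseState.IsAdmissible

variable {R : CrossSection} {S : BaseState} {E : Type*} [NormedAddCommGroup E]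

lemma aemeasurable_density (hS : S.IsAdmissible R) :
    AEMeasurable (fun x => ENNReal.ofReal (S.ρ x)) (volume.restrict R.cell) := by
  have hρ := hS.ρ_reg.bddContinuousOn.memLp_top R.isOpen_D.measurableSet R.ae_mem_D
  exact hρ.aestronglyMeasurable.aemeasurable.ennreal_ofReal

lemma ae_restrict_cell_of_ae_massMeasure (hS : S.IsAdmissible R) {P : ℝ × ℝ → Prop}
    (h : ∀ᵐ x ∂S.massMeasure R, P x) : ∀ᵐ x ∂volume.restrict R.cell, P x := by
  filter_upwards [(ae_withDensity_iff' hS.aemeasurable_density).1 h, R.ae_mem_D] with x hx hxD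
  exact hx (ENNReal.ofReal_pos.2 (hS.density_pos hxD)).ne'

lemma memLp_massMeasure (hS : S.IsAdmissible R) {f : ℝ × ℝ → E} {p : ENNReal}
    (hf : MemLp f p (volume.restrict R.cell)) : MemLp f p (S.massMeasure R) := by
  obtain ⟨C, hC⟩ := hS.ρ_reg.bddContinuousOn.2
  refine hf.of_measure_le_smul (c := ENNReal.ofReal C) ENNReal.ofReal_ne_top ?_
  rw [BaseState.massMeasure, ← withDensity_const]
  refine withDensity_mono (R.ae_mem_D.mono fun x hx => ENNReal.ofReal_le_ofReal ?_)
  exact (le_abs_self _).trans (hC x hx)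

lemma integrable_massMeasure_iff [NormedSpace ℝ E] (hS : S.IsAdmissible R) {f : ℝ × ℝ → E} :
    Integrable f (S.massMeasure R)
      ↔ Integrable (fun x => S.ρ x • f x) (volume.restrict R.cell) := by
  rw [BaseState.massMeasure, integrable_withDensity_iff_integrable_smul₀' hS.aemeasurable_density
    (ae_of_all _ fun _ => ENNReal.ofReal_lt_top)]
  refine integrable_congr (R.ae_mem_D.mono fun x hx => ?_)
  simp only [ENNReal.toReal_ofReal (hS.density_pos hx).le]

lemma integral_massMeasure [NormedSpace ℝ E] (hS : S.IsAdmissible R) (f : ℝ × ℝ → E) :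
    ∫ x, f x ∂S.massMeasure R = ∫ x in R.cell, S.ρ x • f x := by
  rw [BaseState.massMeasure, integral_withDensity_eq_integral_toReal_smul₀ hS.aemeasurable_density
    (ae_of_all _ fun _ => ENNReal.ofReal_lt_top)]
  refine integral_congr_ae (R.ae_mem_D.mono fun x hx => ?_)
  simp only [ENNReal.toReal_ofReal (hS.density_pos hx).le]

end BaseState.IsAdmissible

namespace IsNormalMode

variable {R : CrossSection} {S : BaseState} {k : ℝ} {c : ℂ} {w : Perturbation}

lemma memLp_increment (hw : IsNormalMode R S k c w) {f : ℝ × ℝ → ℝ}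
    (hy : BddContinuousOn (dy f) R.D) (hz : BddContinuousOn (dz f) R.D) :
    MemLp (w.increment S k c f) 2 (volume.restrict R.cell) :=
  ((hy.ofReal.mul_memLp R.isOpen_D.measurableSet R.ae_mem_D hw.memLp_η).add
    (hz.ofReal.mul_memLp R.isOpen_D.measurableSet R.ae_mem_D hw.memLp_ζ)).ae_eq <|
    .of_forall fun x => by simp only [Perturbation.increment, Pi.add_apply, mul_comm]

lemma memLp_compression (hw : IsNormalMode R S k c w) (hS : S.IsAdmissible R) (hc : c.im ≠ 0) :
    MemLp (w.compression S k c) 2 (volume.restrict R.cell) := by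
  have hdiv := hS.bddContinuousOn_s_sq.ofReal.mul_memLp R.isOpen_D.measurableSet R.ae_mem_D
    hw.memLp_div
  have hgrad := hw.memLp_increment hS.bddContinuousOn_dy_G hS.bddContinuousOn_dz_G
  refine ((hS.bddContinuousOn_inv_sq_sub_shifted_sq hc).mul_memLp R.isOpen_D.measurableSet
    R.ae_mem_D (hdiv.add hgrad)).ae_eq (.of_forall fun x => ?_)
  simp only [Perturbation.compression, Perturbation.divergence, Pi.add_apply, ofReal_pow,
    div_eq_inv_mul]

lemma memLp_q (hw : IsNormalMode R S k c w) (hS : S.IsAdmissible R) (hk : k ≠ 0)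
    (hc : c.im ≠ 0) : MemLp w.q 2 (volume.restrict R.cell) := by
  have hcompression := ((hS.bddContinuousOn_shifted c).pow 2).mul_memLp R.isOpen_D.measurableSet
    R.ae_mem_D (hw.memLp_compression hS hc)
  have hdiv := hS.bddContinuousOn_a_sq.ofReal.mul_memLp R.isOpen_D.measurableSet R.ae_mem_D
    hw.memLp_div
  refine (hS.ρ_reg.bddContinuousOn.ofReal.mul_memLp R.isOpen_D.measurableSet R.ae_mem_D
    (hcompression.sub hdiv)).ae_eq (R.ae_mem_D.mono fun x hx => ?_)
  simp only [hw.q_eq hS hk hc hx, Pi.sub_apply, ofReal_pow, Perturbation.divergence]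

lemma memLp_density (hw : IsNormalMode R S k c w) (hS : S.IsAdmissible R) (hk : k ≠ 0)
    (hc : c.im ≠ 0) : MemLp w.ρ 2 (volume.restrict R.cell) :=
  ((hS.ρ_reg.bddContinuousOn.ofReal.mul_memLp R.isOpen_D.measurableSet R.ae_mem_D
    ((hw.memLp_compression hS hc).sub hw.memLp_div)).sub
    (hw.memLp_increment hS.ρ_reg.bddContinuousOn_dy hS.ρ_reg.bddContinuousOn_dz)).ae_eq <|
    R.ae_mem_D.mono fun _ hx => (hw.density_eq hS hk hc hx).symm

lemma memLp_dy_q (hw : IsNormalMode R S k c w) (hS : S.IsAdmissible R) (hk : k ≠ 0)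
    (hc : c.im ≠ 0) : MemLp (dy w.q) 2 (volume.restrict R.cell) :=
  (((hS.bddContinuousOn_inertia k c).mul_memLp R.isOpen_D.measurableSet R.ae_mem_D
    hw.memLp_η).add
    (hS.bddContinuousOn_dy_G.ofReal.mul_memLp R.isOpen_D.measurableSet R.ae_mem_D
      (hw.memLp_density hS hk hc))).ae_eq <|
    R.ae_mem_D.mono fun _ hx => (hw.dy_q_eq hS hk hc hx).symm

lemma memLp_dz_q (hw : IsNormalMode R S k c w) (hS : S.IsAdmissible R) (hk : k ≠ 0)
    (hc : c.im ≠ 0) : MemLp (dz w.q) 2 (volume.restrict R.cell) :=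
  (((hS.bddContinuousOn_inertia k c).mul_memLp R.isOpen_D.measurableSet R.ae_mem_D
    hw.memLp_ζ).add
    (hS.bddContinuousOn_dz_G.ofReal.mul_memLp R.isOpen_D.measurableSet R.ae_mem_D
      (hw.memLp_density hS hk hc))).ae_eq <|
    R.ae_mem_D.mono fun _ hx => (hw.dz_q_eq hS hk hc hx).symm

end IsNormalMode

/-! ### Energy densities and the weighted energy balance -/

namespace Perturbation

variable (w : Perturbation) (S : BaseState) (k : ℝ) (c : ℂ) (x : ℝ × ℝ)

/-- The squared length `|η|² + |ζ|²` of the displacement. -/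
def dispSq : ℝ := ‖w.η S k c x‖ ^ 2 + ‖w.ζ S k c x‖ ^ 2

/-- The buoyancy energy `N₁² |η|² + N₂² |ζ|² + 2 N₁₂² Re (η conj ζ)` per unit mass. -/
def buoyancy : ℝ :=
  hermitianForm (S.N1sq x) (S.N2sq x) (S.N12sq x) (w.η S k c x) (w.ζ S k c x)

/-- The kinetic energy `k² (|η|² + |ζ|²) + |P|²` per unit mass and per unit of `|U|²`; here `P / k`
is, up to a phase, the streamwise displacement. -/
def kinetic : ℝ := k ^ 2 * w.dispSq S k c x + ‖w.compression S k c x‖ ^ 2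

/-- The potential energy per unit mass: magnetic tension, compression of the gas, compression of the
magnetic field, and buoyancy. -/
def potential : ℝ :=
  k ^ 2 * S.a x ^ 2 * w.dispSq S k c x
    + ‖shifted S c x‖ ^ 4 / S.s x ^ 2 * ‖w.compression S k c x‖ ^ 2
    + S.a x ^ 2 * ‖w.divergence S k c x‖ ^ 2 + w.buoyancy S k c x

/-- The total pressure amplitude per unit mass, `U² P - a² (η_y + ζ_z)`. -/
def pressureRatio : ℂ :=
  shifted S c x ^ 2 * w.compression S k c x - (S.a x : ℂ) ^ 2 * w.divergence S k c x

/-- The momentum balance tested with `φ(u)` times the conjugate displacement, per unit mass. -/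
def weightedEnergy (φ : ℝ → ℂ) : ℂ :=
  φ (S.u x) * (shifted S c x ^ 2 * w.kinetic S k c x - w.potential S k c x)
    + deriv φ (S.u x) * w.pressureRatio S k c x * conj (w.increment S k c S.u x)

lemma conj_increment (f : ℝ × ℝ → ℝ) :
    conj (w.increment S k c f x) = conj (w.η S k c x) * dy f x + conj (w.ζ S k c x) * dz f x := by
  simp only [increment, map_add, map_mul, conj_ofReal]

lemma dispSq_nonneg : 0 ≤ w.dispSq S k c x := by
  rw [dispSq]
  positivity

lemma kinetic_nonneg : 0 ≤ w.kinetic S k c x :=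
  add_nonneg (mul_nonneg (sq_nonneg k) (w.dispSq_nonneg S k c x)) (sq_nonneg _)

end Perturbation

variable {R : CrossSection} {S : BaseState} {x : ℝ × ℝ}

lemma BaseState.IsAdmissible.buoyancy_nonneg (hS : S.IsAdmissible R) (w : Perturbation) (k : ℝ)
    (c : ℂ) (hx : x ∈ R.D) (hN : 0 ≤ S.N1sq x + S.N2sq x) : 0 ≤ w.buoyancy S k c x :=
  hermitianForm_nonneg (hS.N1sq_nonneg hx hN) (hS.N2sq_nonneg hx hN)
    (hS.N1sq_mul_N2sq hx).ge _ _

lemma BaseState.IsAdmissible.Jm_mul_le_buoyancy (hS : S.IsAdmissible R) (w : Perturbation) (k : ℝ)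
    (c : ℂ) (hx : x ∈ R.D) :
    S.Jm R * ‖w.increment S k c S.u x‖ ^ 2
      ≤ w.buoyancy S k c x + S.lamM R * w.dispSq S k c x := by
  have heigen := minEigenvalue_mul_le_hermitianForm (S.N1sq x - S.Jm R * dy S.u x ^ 2)
    (S.N2sq x - S.Jm R * dz S.u x ^ 2) (S.N12sq x - S.Jm R * (dy S.u x * dz S.u x))
    (w.η S k c x) (w.ζ S k c x)
  have hshear : hermitianForm (S.Jm R * dy S.u x ^ 2) (S.Jm R * dz S.u x ^ 2)
      (S.Jm R * (dy S.u x * dz S.u x)) (w.η S k c x) (w.ζ S k c x)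
      = S.Jm R * ‖w.increment S k c S.u x‖ ^ 2 := by
    rw [Perturbation.increment, mul_comm (w.η S k c x), mul_comm (w.ζ S k c x),
      ← hermitianForm_rankOne]
    simp only [hermitianForm]
    ring
  have hmax : S.misalignment R x * w.dispSq S k c x ≤ S.lamM R * w.dispSq S k c x :=
    mul_le_mul_of_nonneg_right (hS.misalignment_le hx) (w.dispSq_nonneg S k c x)
  rw [hermitianForm_sub, hshear] at heigen
  rw [hS.misalignment_eq_neg_minEigenvalue hx, neg_mul] at hmax
  simp only [Perturbation.buoyancy, Perturbation.dispSq] at hmax ⊢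
  linarith

lemma BaseState.Θ_mul_kinetic_add_buoyancy_le (S : BaseState) (w : Perturbation) (k : ℝ) (c : ℂ)
    (hx : x ∈ R.D) :
    S.Θ R c * w.kinetic S k c x + w.buoyancy S k c x ≤ w.potential S k c x := by
  have hΘ := S.Θ_le c hx
  have hcompression : S.Θ R c * ‖w.compression S k c x‖ ^ 2
      ≤ ‖shifted S c x‖ ^ 4 / S.s x ^ 2 * ‖w.compression S k c x‖ ^ 2 := by
    gcongr
    refine (hΘ.trans (min_le_right _ _)).trans ?_
    rw [← Even.pow_abs (by decide : Even 4) c.im]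
    gcongr
    exact abs_im_le_norm_shifted S c x
  have htension : k ^ 2 * w.dispSq S k c x * S.Θ R c ≤ k ^ 2 * w.dispSq S k c x * S.a x ^ 2 :=
    mul_le_mul_of_nonneg_left (hΘ.trans (min_le_left _ _))
      (mul_nonneg (sq_nonneg k) (w.dispSq_nonneg S k c x))
  have hmagnetic : 0 ≤ S.a x ^ 2 * ‖w.divergence S k c x‖ ^ 2 := by positivity
  simp only [Perturbation.kinetic, Perturbation.potential]
  linarith

section Mode

variable {k : ℝ} {c : ℂ} {w : Perturbation}

lemma BaseState.IsAdmissible.buoyancy_eq (hS : S.IsAdmissible R) (w : Perturbation) (k : ℝ) (c : ℂ)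
    (hx : x ∈ R.D) :
    (w.buoyancy S k c x : ℂ)
      = w.increment S k c S.ρ x * conj (w.increment S k c S.G x) / S.ρ x
        - ‖w.increment S k c S.G x‖ ^ 2 / (S.s x : ℂ) ^ 2 := by
  have hρ : (S.ρ x : ℂ) ≠ 0 := by exact_mod_cast (hS.density_pos hx).ne'
  have hs : (S.s x : ℂ) ≠ 0 := by simpa using (hS.s_sq_pos hx).ne'
  have hparallel : (dz S.G x * dy S.ρ x : ℂ) = dy S.G x * dz S.ρ x := by
    exact_mod_cast hS.dz_G_mul_dy_density hx
  have hcross : (2 * (w.η S k c x * conj (w.ζ S k c x)).re : ℂ)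
      = w.η S k c x * conj (w.ζ S k c x) + conj (w.η S k c x) * w.ζ S k c x := by
    have := Complex.add_conj (w.η S k c x * conj (w.ζ S k c x))
    simp only [map_mul, conj_conj] at this
    rw [this]
    push_cast
    rfl
  rw [← Complex.mul_conj', Perturbation.buoyancy, hermitianForm]
  push_cast
  rw [mul_right_comm, hcross, ← Complex.mul_conj', ← Complex.mul_conj']
  rw [w.conj_increment]
  simp only [Perturbation.increment, BaseState.N1sq, BaseState.N2sq, BaseState.N12sq]
  push_cast
  field_simp
  linear_combination (S.s x : ℂ) ^ 2 * conj (w.η S k c x) * w.ζ S k c x * hparallel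

lemma BaseState.IsAdmissible.compression_balance (hS : S.IsAdmissible R) (w : Perturbation)
    (k : ℝ) (hc : c.im ≠ 0) (hx : x ∈ R.D) :
    shifted S c x ^ 2 * w.compression S k c x * conj (w.divergence S k c x)
        + (w.compression S k c x - w.divergence S k c x) * conj (w.increment S k c S.G x)
      = shifted S c x ^ 2 * ‖w.compression S k c x‖ ^ 2
        - ‖shifted S c x‖ ^ 4 / (S.s x : ℂ) ^ 2 * ‖w.compression S k c x‖ ^ 2
        + ‖w.increment S k c S.G x‖ ^ 2 / (S.s x : ℂ) ^ 2 := by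
  have hs : (S.s x : ℂ) ≠ 0 := by simpa using (hS.s_sq_pos hx).ne'
  have hP := w.sq_sub_shifted_sq_mul_compression (k := k) S hc x
  have hPconj := congrArg conj hP
  simp only [map_mul, map_sub, map_add, map_pow, conj_ofReal] at hPconj
  rw [show (‖shifted S c x‖ : ℂ) ^ 4 = (‖shifted S c x‖ ^ 2) ^ 2 by ring]
  simp only [← Complex.mul_conj']
  field_simp
  linear_combination (-shifted S c x ^ 2 * w.compression S k c x) * hPconj
    + conj (w.increment S k c S.G x) * hP

namespace IsNormalMode

lemma momentum_balance (hw : IsNormalMode R S k c w) (hS : S.IsAdmissible R) (hk : k ≠ 0)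
    (hc : c.im ≠ 0) (hx : x ∈ R.D) :
    w.q x * conj (w.divergence S k c x)
        + (dy w.q x * conj (w.η S k c x) + dz w.q x * conj (w.ζ S k c x))
      = S.ρ x * (shifted S c x ^ 2 * w.kinetic S k c x - w.potential S k c x) := by
  have hρ : (S.ρ x : ℂ) ≠ 0 := by exact_mod_cast (hS.density_pos hx).ne'
  have hbuoyancy := hS.buoyancy_eq w k c hx
  have hcompression := hS.compression_balance w k hc hx
  rw [eq_sub_iff_add_eq, eq_div_iff hρ] at hbuoyancy
  rw [hw.q_eq hS hk hc hx, hw.dy_q_eq hS hk hc hx, hw.dz_q_eq hS hk hc hx,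
    hw.density_eq hS hk hc hx]
  have hconj := w.conj_increment S k c x S.G
  simp only [Perturbation.kinetic, Perturbation.potential, Perturbation.dispSq]
  push_cast
  linear_combination S.ρ x * hcompression + hbuoyancy
    - (S.ρ x * (w.compression S k c x - w.divergence S k c x) - w.increment S k c S.ρ x) * hconj
    + k ^ 2 * S.ρ x * (shifted S c x ^ 2 - (S.a x : ℂ) ^ 2)
      * (Complex.mul_conj' (w.η S k c x) + Complex.mul_conj' (w.ζ S k c x))
    - (S.ρ x * S.a x ^ 2) * Complex.mul_conj' (w.divergence S k c x)

end IsNormalMode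

end Mode

lemma fderiv_conj_comp_mul_apply {E : Type*} [NormedAddCommGroup E] [NormedSpace ℝ E] {x : E}
    {φ : ℝ → ℂ} {f : E → ℝ} {q : E → ℂ} (hφ : DifferentiableAt ℝ φ (f x))
    (hf : DifferentiableAt ℝ f x) (hq : DifferentiableAt ℝ q x) (v : E) :
    fderiv ℝ (fun y => conj (φ (f y) * q y)) x v
      = conj (deriv φ (f x) * (fderiv ℝ f x v : ℝ) * q x + φ (f x) * fderiv ℝ q x v) := by
  have hφf : DifferentiableAt ℝ (fun y => φ (f y)) x := hφ.comp x hf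
  rw [fderiv_conj_apply, fderiv_fun_mul hφf hq]
  simp only [_root_.add_apply, _root_.smul_apply, smul_eq_mul, fderiv_comp_real_apply hφ hf]
  ring_nf

namespace IsNormalMode

variable {R : CrossSection} {S : BaseState} {k : ℝ} {c : ℂ} {w : Perturbation} {φ : ℝ → ℂ}

lemma q_periodic (hw : IsNormalMode R S k c w) : R.IsPeriodic w.q := fun l hl x hx => by
  have h := hw.periodic l hl x hx
  simp only [Prod.mk.injEq] at h
  exact h.2.2.2.2.2.2.2

lemma fderiv_weighted_q_apply (hw : IsNormalMode R S k c w) (hS : S.IsAdmissible R)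
    (hφ : ContDiff ℝ 1 φ) {x : ℝ × ℝ} (hx : x ∈ R.D) (v : ℝ × ℝ) :
    fderiv ℝ (fun y => conj (φ (S.u y) * w.q y)) x v
      = conj (deriv φ (S.u x) * (fderiv ℝ S.u x v : ℝ) * w.q x
        + φ (S.u x) * fderiv ℝ w.q x v) :=
  fderiv_conj_comp_mul_apply (hφ.differentiable one_ne_zero _) (hS.u_reg.differentiableAt hx)
    ((hw.q_reg.contDiffAt (R.isOpen_D.mem_nhds hx)).differentiableAt one_ne_zero) v

lemma memLp_fderiv_weighted_q_apply (hw : IsNormalMode R S k c w) (hS : S.IsAdmissible R)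
    (hk : k ≠ 0) (hc : c.im ≠ 0) (hφ : ContDiff ℝ 1 φ) {v : ℝ × ℝ}
    (hu : BddContinuousOn (fun x => fderiv ℝ S.u x v) R.D)
    (hq : MemLp (fun x => fderiv ℝ w.q x v) 2 (volume.restrict R.cell)) :
    MemLp (fun x => fderiv ℝ (fun y => conj (φ (S.u y) * w.q y)) x v) 2
      (volume.restrict R.cell) := by
  have hD := R.isOpen_D.measurableSet
  have hb := (hS.u_reg.bddContinuousOn.comp (hφ.continuous_deriv le_rfl)).mul hu.ofReal
  refine (((hb.mul_memLp hD R.ae_mem_D (hw.memLp_q hS hk hc)).add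
    ((hS.u_reg.bddContinuousOn.comp hφ.continuous).mul_memLp hD R.ae_mem_D hq)).star).ae_eq ?_
  filter_upwards [R.ae_mem_D] with x hx
  exact (hw.fderiv_weighted_q_apply hS hφ hx v).symm

lemma tendsto_weighted_q (hw : IsNormalMode R S k c w) (hS : S.IsAdmissible R)
    (hφ : Continuous φ) {x : ℝ × ℝ} (hx : x ∈ R.free) :
    Tendsto (fun y => conj (φ (S.u y) * w.q y)) (𝓝[R.D] x) (𝓝 0) := by
  obtain ⟨C, hC⟩ := (hS.u_reg.bddContinuousOn.comp hφ).2
  have hq : Tendsto (fun y => C * ‖w.q y‖) (𝓝[R.D] x) (𝓝 0) := by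
    simpa using (hw.free_surface x hx).norm.const_mul C
  refine squeeze_zero_norm' ?_ hq
  filter_upwards [self_mem_nhdsWithin] with y hy
  rw [RCLike.norm_conj, norm_mul]
  gcongr
  exact hC y hy

lemma isTest_weighted_q (hw : IsNormalMode R S k c w) (hS : S.IsAdmissible R) (hk : k ≠ 0)
    (hc : c.im ≠ 0) (hφ : ContDiff ℝ 1 φ) : R.IsTest fun x => conj (φ (S.u x) * w.q x) where
  contDiffOn :=
    Complex.conjCLE.contDiff.comp_contDiffOn ((hφ.comp_contDiffOn hS.u_reg.1).mul hw.q_reg)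
  periodic l hl x hx := by
    simp only [hS.u_periodic l hl x hx, hw.q_periodic l hl x hx]
  memLp := ((hS.u_reg.bddContinuousOn.comp hφ.continuous).mul_memLp R.isOpen_D.measurableSet
    R.ae_mem_D (hw.memLp_q hS hk hc)).star
  memLp_dy := hw.memLp_fderiv_weighted_q_apply hS hk hc hφ hS.u_reg.bddContinuousOn_dy
    (hw.memLp_dy_q hS hk hc)
  memLp_dz := hw.memLp_fderiv_weighted_q_apply hS hk hc hφ hS.u_reg.bddContinuousOn_dz
    (hw.memLp_dz_q hS hk hc)
  free _ hx := hw.tendsto_weighted_q hS hφ.continuous hx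

lemma conj_tested_eq_density_smul_weightedEnergy (hw : IsNormalMode R S k c w)
    (hS : S.IsAdmissible R) (hk : k ≠ 0) (hc : c.im ≠ 0) (hφ : ContDiff ℝ 1 φ) {x : ℝ × ℝ}
    (hx : x ∈ R.D) :
    conj (conj (φ (S.u x) * w.q x) * (dy (w.η S k c) x + dz (w.ζ S k c) x)
        + (dy (fun y => conj (φ (S.u y) * w.q y)) x * w.η S k c x
          + dz (fun y => conj (φ (S.u y) * w.q y)) x * w.ζ S k c x))
      = S.ρ x • w.weightedEnergy S k c x φ := by
  have hmomentum := hw.momentum_balance hS hk hc hx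
  have hq : w.q x = S.ρ x * w.pressureRatio S k c x := hw.q_eq hS hk hc hx
  have hconj := w.conj_increment S k c x S.u
  simp only [Perturbation.divergence, dy, dz, map_add] at hmomentum hconj
  simp only [dy, dz, hw.fderiv_weighted_q_apply hS hφ hx]
  simp only [map_add, map_mul, conj_conj, Perturbation.weightedEnergy, real_smul]
  linear_combination φ (S.u x) * hmomentum - deriv φ (S.u x) * w.q x * hconj
    + deriv φ (S.u x) * conj (w.increment S k c S.u x) * hq

lemma integrable_weightedEnergy (hw : IsNormalMode R S k c w) (hS : S.IsAdmissible R)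
    (hk : k ≠ 0) (hc : c.im ≠ 0) (hφ : ContDiff ℝ 1 φ) :
    Integrable (fun x => w.weightedEnergy S k c x φ) (S.massMeasure R) := by
  have htest := hw.isTest_weighted_q hS hk hc hφ
  have hintegrable := (htest.memLp.integrable_mul hw.memLp_div).add
    ((htest.memLp_dy.integrable_mul hw.memLp_η).add (htest.memLp_dz.integrable_mul hw.memLp_ζ))
  refine hS.integrable_massMeasure_iff.2
    (((Complex.conjCLE : ℂ →L[ℝ] ℂ).integrable_comp hintegrable).congr ?_)
  filter_upwards [R.ae_mem_D] with x hx
  exact hw.conj_tested_eq_density_smul_weightedEnergy hS hk hc hφ hx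

lemma integral_weightedEnergy (hw : IsNormalMode R S k c w) (hS : S.IsAdmissible R)
    (hk : k ≠ 0) (hc : c.im ≠ 0) (hφ : ContDiff ℝ 1 φ) :
    ∫ x, w.weightedEnergy S k c x φ ∂S.massMeasure R = 0 := by
  have htested := hw.impermeable _ (hw.isTest_weighted_q hS hk hc hφ)
  have hae : ∀ᵐ x ∂volume.restrict R.cell, _ := R.ae_mem_D.mono fun x hx =>
    hw.conj_tested_eq_density_smul_weightedEnergy hS hk hc hφ hx
  rw [hS.integral_massMeasure, ← integral_congr_ae hae, integral_conj, htested, map_zero]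

end IsNormalMode

namespace IsNormalMode

variable {R : CrossSection} {S : BaseState} {k : ℝ} {c : ℂ} {w : Perturbation}

lemma displacement_periodic (hw : IsNormalMode R S k c w) (hS : S.IsAdmissible R) :
    R.IsPeriodic fun x => (w.η S k c x, w.ζ S k c x) := fun l hl x hx => by
  have h := hw.periodic l hl x hx
  simp only [Prod.mk.injEq] at h
  simp only [Perturbation.η, Perturbation.ζ, shifted, hS.u_periodic l hl x hx, h.2.1, h.2.2.1]

lemma exists_displacement_ne_zero (hw : IsNormalMode R S k c w) (hS : S.IsAdmissible R)
    (hk : k ≠ 0) (hc : c.im ≠ 0) : ∃ x ∈ R.D, w.η S k c x ≠ 0 ∨ w.ζ S k c x ≠ 0 := by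
  obtain ⟨x, hx, hne⟩ := hw.nontrivial
  by_contra! h
  have hη : w.η S k c =ᶠ[𝓝 x] fun _ => 0 :=
    eventually_of_mem (R.isOpen_D.mem_nhds hx) fun y hy => (h y hy).1
  have hζ : w.ζ S k c =ᶠ[𝓝 x] fun _ => 0 :=
    eventually_of_mem (R.isOpen_D.mem_nhds hx) fun y hy => (h y hy).2
  have hdiv : w.divergence S k c x = 0 := by
    simp [Perturbation.divergence, dy, dz, hη.fderiv_eq, hζ.fderiv_eq]
  have hinc (f : ℝ × ℝ → ℝ) : w.increment S k c f x = 0 := by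
    simp [Perturbation.increment, h x hx]
  have hcomp : w.compression S k c x = 0 := by simp [Perturbation.compression, hdiv, hinc]
  apply hne
  rw [hw.vx_eq hS hk hc hx, w.vy_eq S hk hc, w.vz_eq S hk hc, hw.bx_eq hS hk hc hx,
    hw.bY_eq hk hc hx, hw.bz_eq hk hc hx, hw.density_eq hS hk hc hx, hw.q_eq hS hk hc hx]
  simp [h x hx, hdiv, hinc, hcomp]

lemma not_ae_displacement_eq_zero (hw : IsNormalMode R S k c w) (hS : S.IsAdmissible R)
    (hk : k ≠ 0) (hc : c.im ≠ 0) :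
    ¬ ∀ᵐ x ∂volume.restrict R.cell, (w.η S k c x, w.ζ S k c x) = 0 := by
  intro h
  have hae : ∀ᵐ x ∂volume.restrict R.D, (w.η S k c x, w.ζ S k c x) = 0 := by
    refine R.ae_restrict_D_of_ae_restrict_cell (fun l hl x hx hzero => ?_) h
    exact (hw.displacement_periodic hS l hl x hx).symm.trans hzero
  have hzero : EqOn (fun x => (w.η S k c x, w.ζ S k c x)) 0 R.D :=
    Measure.eqOn_open_of_ae_eq hae R.isOpen_D
      ((hw.contDiffOn_η hS hk hc).continuousOn.prodMk (hw.contDiffOn_ζ hS hk hc).continuousOn)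
      continuousOn_const
  obtain ⟨x, hx, hne⟩ := hw.exists_displacement_ne_zero hS hk hc
  obtain ⟨hη, hζ⟩ := Prod.mk.inj (hzero hx)
  exact hne.elim (· hη) (· hζ)

lemma integrable_dispSq (hw : IsNormalMode R S k c w) (hS : S.IsAdmissible R) :
    Integrable (w.dispSq S k c) (S.massMeasure R) :=
  ((hS.memLp_massMeasure hw.memLp_η).integrable_norm_pow two_ne_zero).add
    ((hS.memLp_massMeasure hw.memLp_ζ).integrable_norm_pow two_ne_zero)

lemma integral_mul_dispSq_pos (hw : IsNormalMode R S k c w) (hS : S.IsAdmissible R)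
    (hk : k ≠ 0) (hc : c.im ≠ 0) {b : ℝ × ℝ → ℝ} (hb : BddContinuousOn b R.D)
    (hb_pos : ∀ x ∈ R.D, 0 < b x) :
    0 < ∫ x, b x * w.dispSq S k c x ∂S.massMeasure R := by
  have hnonneg : 0 ≤ᵐ[S.massMeasure R] fun x => b x * w.dispSq S k c x :=
    (S.ae_mem_D R).mono fun x hx => mul_nonneg (hb_pos x hx).le (w.dispSq_nonneg S k c x)
  have hintegrable := hb.mul_integrable R.isOpen_D.measurableSet (S.ae_mem_D R)
    (hw.integrable_dispSq hS)
  refine (integral_nonneg_of_ae hnonneg).lt_of_ne' fun h => ?_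
  refine hw.not_ae_displacement_eq_zero hS hk hc
    (hS.ae_restrict_cell_of_ae_massMeasure ?_)
  filter_upwards [(integral_eq_zero_iff_of_nonneg_ae hnonneg hintegrable).1 h, S.ae_mem_D R]
    with x hx hxD
  have hdisp : w.dispSq S k c x = 0 := (mul_eq_zero.1 hx).resolve_left (hb_pos x hxD).ne'
  obtain ⟨hη, hζ⟩ := (add_eq_zero_iff_of_nonneg (sq_nonneg _) (sq_nonneg _)).1 hdisp
  simpa using And.intro hη hζ

end IsNormalMode

/-! ### The semicircle bound -/

namespace IsNormalMode

variable {R : CrossSection} {S : BaseState} {k : ℝ} {c : ℂ} {w : Perturbation}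

lemma integrable_norm_increment_u_sq (hw : IsNormalMode R S k c w) (hS : S.IsAdmissible R) :
    Integrable (fun x => ‖w.increment S k c S.u x‖ ^ 2) (S.massMeasure R) :=
  (hS.memLp_massMeasure (hw.memLp_increment hS.u_reg.bddContinuousOn_dy
    hS.u_reg.bddContinuousOn_dz)).integrable_norm_pow two_ne_zero

lemma integrable_norm_compression_sq (hw : IsNormalMode R S k c w) (hS : S.IsAdmissible R)
    (hc : c.im ≠ 0) :
    Integrable (fun x => ‖w.compression S k c x‖ ^ 2) (S.massMeasure R) :=
  (hS.memLp_massMeasure (hw.memLp_compression hS hc)).integrable_norm_pow two_ne_zero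

lemma integrable_kinetic (hw : IsNormalMode R S k c w) (hS : S.IsAdmissible R) (hc : c.im ≠ 0) :
    Integrable (w.kinetic S k c) (S.massMeasure R) :=
  ((hw.integrable_dispSq hS).const_mul (k ^ 2)).add (hw.integrable_norm_compression_sq hS hc)

lemma integrable_buoyancy (hw : IsNormalMode R S k c w) (hS : S.IsAdmissible R) :
    Integrable (w.buoyancy S k c) (S.massMeasure R) := by
  have hη := hS.memLp_massMeasure hw.memLp_η
  have hζ := hS.memLp_massMeasure hw.memLp_ζ
  have hcross : Integrable (fun x => (w.η S k c x * conj (w.ζ S k c x)).re) (S.massMeasure R) :=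
    (hη.integrable_mul hζ.star).re
  have hmul {b f : ℝ × ℝ → ℝ} (hb : BddContinuousOn b R.D) (hf : Integrable f (S.massMeasure R)) :
      Integrable (fun x => b x * f x) (S.massMeasure R) :=
    hb.mul_integrable R.isOpen_D.measurableSet (S.ae_mem_D R) hf
  refine (((hmul hS.bddContinuousOn_N1sq (hη.integrable_norm_pow two_ne_zero)).add
    (hmul hS.bddContinuousOn_N2sq (hζ.integrable_norm_pow two_ne_zero))).add
    ((hmul hS.bddContinuousOn_N12sq hcross).const_mul 2)).congr (.of_forall fun x => ?_)
  simp only [Perturbation.buoyancy, hermitianForm, Pi.add_apply]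
  ring

lemma integral_kinetic_pos (hw : IsNormalMode R S k c w) (hS : S.IsAdmissible R)
    (hk : k ≠ 0) (hc : c.im ≠ 0) : 0 < ∫ x, w.kinetic S k c x ∂S.massMeasure R := by
  refine (hw.integral_mul_dispSq_pos hS hk hc (.const (k ^ 2)) fun _ _ => by positivity).trans_le
    (integral_mono ((hw.integrable_dispSq hS).const_mul _) (hw.integrable_kinetic hS hc)
      fun x => ?_)
  exact le_add_of_nonneg_right (sq_nonneg _)

end IsNormalMode

lemma BaseState.IsAdmissible.integral_buoyancy_nonneg {R : CrossSection} {S : BaseState}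
    (hS : S.IsAdmissible R) (w : Perturbation) (k : ℝ) (c : ℂ)
    (hN : ∀ x ∈ R.D, 0 ≤ S.N1sq x + S.N2sq x) :
    0 ≤ ∫ x, w.buoyancy S k c x ∂S.massMeasure R :=
  integral_nonneg_of_ae <|
    (S.ae_mem_D R).mono fun x hx => hS.buoyancy_nonneg w k c hx (hN x hx)

lemma Perturbation.weightedEnergy_one (w : Perturbation) (S : BaseState) (k : ℝ) (c : ℂ)
    (x : ℝ × ℝ) :
    w.weightedEnergy S k c x (fun _ => 1)
      = shifted S c x ^ 2 * w.kinetic S k c x - w.potential S k c x := by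
  simp only [Perturbation.weightedEnergy, deriv_const, one_mul, zero_mul, add_zero]

/-- Subtracting `(c_r - u₊) / c_i` times the imaginary part turns `(u - c_r)²` into
`(u - u₊)² - (c_r - u₊)²`. -/
lemma BaseState.IsAdmissible.semicircle_density_le {R : CrossSection} {S : BaseState}
    (hS : S.IsAdmissible R) (w : Perturbation) (k : ℝ) {c : ℂ} (hc : c.im ≠ 0) {x : ℝ × ℝ}
    (hx : x ∈ R.D) :
    ((c.re - S.uPlus R) ^ 2 + c.im ^ 2 - S.uMinus R ^ 2 + S.Θ R c) * w.kinetic S k c x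
        + w.buoyancy S k c x
      ≤ (c.re - S.uPlus R) / c.im * (w.weightedEnergy S k c x fun _ => 1).im
        - (w.weightedEnergy S k c x fun _ => 1).re := by
  have hre : (w.weightedEnergy S k c x fun _ => 1).re
      = ((S.u x - c.re) ^ 2 - c.im ^ 2) * w.kinetic S k c x - w.potential S k c x := by
    rw [w.weightedEnergy_one, sub_re, re_mul_ofReal, ofReal_re, sq, mul_re, shifted_re, shifted_im]
    ring
  have him : (c.re - S.uPlus R) / c.im * (w.weightedEnergy S k c x fun _ => 1).im
      = -(2 * (c.re - S.uPlus R) * (S.u x - c.re) * w.kinetic S k c x) := by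
    rw [w.weightedEnergy_one, sub_im, im_mul_ofReal, ofReal_im, sq, mul_im, shifted_re, shifted_im]
    field_simp
    ring
  have hpotential := S.Θ_mul_kinetic_add_buoyancy_le w k c hx
  have hvelocity := mul_le_mul_of_nonneg_right (hS.u_sub_uPlus_sq_le hx) (w.kinetic_nonneg S k c x)
  rw [hre, him]
  linarith

namespace IsNormalMode

variable {R : CrossSection} {S : BaseState} {k : ℝ} {c : ℂ} {w : Perturbation} {φ : ℝ → ℂ}

lemma integral_weightedEnergy_re (hw : IsNormalMode R S k c w) (hS : S.IsAdmissible R)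
    (hk : k ≠ 0) (hc : c.im ≠ 0) (hφ : ContDiff ℝ 1 φ) :
    ∫ x, (w.weightedEnergy S k c x φ).re ∂S.massMeasure R = 0 := by
  have h := integral_re (hw.integrable_weightedEnergy hS hk hc hφ)
  rwa [hw.integral_weightedEnergy hS hk hc hφ, map_zero] at h

lemma integral_weightedEnergy_im (hw : IsNormalMode R S k c w) (hS : S.IsAdmissible R)
    (hk : k ≠ 0) (hc : c.im ≠ 0) (hφ : ContDiff ℝ 1 φ) :
    ∫ x, (w.weightedEnergy S k c x φ).im ∂S.massMeasure R = 0 := by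
  have h := integral_im (hw.integrable_weightedEnergy hS hk hc hφ)
  rwa [hw.integral_weightedEnergy hS hk hc hφ, map_zero] at h

lemma semicircle_le (hw : IsNormalMode R S k c w) (hS : S.IsAdmissible R) (hk : k ≠ 0)
    (hc : c.im ≠ 0) :
    ((c.re - S.uPlus R) ^ 2 + c.im ^ 2 - S.uMinus R ^ 2 + S.Θ R c)
        * ∫ x, w.kinetic S k c x ∂S.massMeasure R
      + ∫ x, w.buoyancy S k c x ∂S.massMeasure R ≤ 0 := by
  have hkinetic := (hw.integrable_kinetic hS hc).const_mul
    ((c.re - S.uPlus R) ^ 2 + c.im ^ 2 - S.uMinus R ^ 2 + S.Θ R c)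
  have hintegrable := hw.integrable_weightedEnergy hS hk hc (φ := fun _ => 1) contDiff_const
  have him := hintegrable.im.const_mul ((c.re - S.uPlus R) / c.im)
  have hbound := integral_mono_ae (hkinetic.add (hw.integrable_buoyancy hS))
    (him.sub hintegrable.re)
    ((S.ae_mem_D R).mono fun x hx => hS.semicircle_density_le w k hc hx)
  rw [← integral_const_mul, ← integral_add hkinetic (hw.integrable_buoyancy hS)]
  refine hbound.trans_eq ?_
  rw [integral_sub' him hintegrable.re, integral_const_mul]
  simp only [RCLike.re_to_complex, RCLike.im_to_complex,
    hw.integral_weightedEnergy_re hS hk hc contDiff_const,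
    hw.integral_weightedEnergy_im hS hk hc contDiff_const, mul_zero, sub_zero]

end IsNormalMode

/-! ### The phase weight -/

/-- The phase `|t - c| / (t - c)`; the weight `phase c u` makes the kinetic part `U² K` of the
energy density a multiple of `U`, whose imaginary part `-c_i` is constant. -/
def phase (c : ℂ) (t : ℝ) : ℂ := conj ((t : ℂ) - c) * (‖(t : ℂ) - c‖ : ℂ)⁻¹

lemma ofReal_sub_ne_zero {c : ℂ} (hc : c.im ≠ 0) (t : ℝ) : (t : ℂ) - c ≠ 0 := fun h =>
  hc (by simpa using congrArg im h)

lemma contDiff_phase {c : ℂ} (hc : c.im ≠ 0) : ContDiff ℝ 1 (phase c) := by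
  have hsub : ContDiff ℝ 1 fun t : ℝ => (t : ℂ) - c := ofRealCLM.contDiff.sub contDiff_const
  exact (conjCLE.contDiff.comp hsub).mul <|
    (ofRealCLM.contDiff.comp (hsub.norm ℝ (ofReal_sub_ne_zero hc))).inv fun t => by
      simpa using ofReal_sub_ne_zero hc t

lemma phase_sq_mul {c : ℂ} (hc : c.im ≠ 0) (t : ℝ) :
    phase c t ^ 2 * ((t : ℂ) - c) = (t : ℂ) - conj c := by
  have hz := ofReal_sub_ne_zero hc t
  have : (‖(t : ℂ) - c‖ : ℂ) ≠ 0 := by exact_mod_cast norm_ne_zero_iff.2 hz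
  have hsq : conj ((t : ℂ) - c) * ((t : ℂ) - c) = ‖(t : ℂ) - c‖ ^ 2 := conj_mul' _
  rw [phase, mul_pow, inv_pow, ← hsq, map_sub, conj_ofReal]
  have hz' : (t : ℂ) - conj c ≠ 0 := by simpa using (map_ne_zero (starRingEnd ℂ)).2 hz
  field_simp

lemma deriv_phase {c : ℂ} (hc : c.im ≠ 0) (t : ℝ) :
    deriv (phase c) t = -(I * c.im) * phase c t / (‖(t : ℂ) - c‖ : ℂ) ^ 2 := by
  have hz := ofReal_sub_ne_zero hc t
  have hz' : (t : ℂ) - conj c ≠ 0 := by simpa using (map_ne_zero (starRingEnd ℂ)).2 hz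
  have hsq := phase_sq_mul hc t
  have hphase : phase c t ≠ 0 := fun h => hz' (by simpa [h] using hsq.symm)
  have hφ := ((contDiff_phase hc).differentiable one_ne_zero t).hasDerivAt
  have hderiv : 2 * phase c t * deriv (phase c) t * ((t : ℂ) - c) + phase c t ^ 2 = 1 := by
    simpa using ((hφ.pow 2).mul (ofRealCLM.hasDerivAt.sub_const c)).unique
      ((ofRealCLM.hasDerivAt.sub_const (conj c)).congr_of_eventuallyEq
        (.of_forall fun s => phase_sq_mul hc s))
  have him : (t : ℂ) - c - ((t : ℂ) - conj c) = -2 * I * c.im := by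
    have := sub_conj c
    push_cast at this
    linear_combination -this
  have hnorm : ((t : ℂ) - c) * ((t : ℂ) - conj c) = ‖(t : ℂ) - c‖ ^ 2 := by
    simpa using mul_conj' ((t : ℂ) - c)
  rw [← hnorm, eq_div_iff (mul_ne_zero hz hz')]
  refine mul_left_cancel₀ hphase ?_
  linear_combination ((t : ℂ) - conj c) / 2 * hderiv - hsq / 2 + phase c t ^ 2 / 2 * him

lemma Perturbation.im_weightedEnergy_phase (w : Perturbation) (S : BaseState) (k : ℝ) {c : ℂ}
    (hc : c.im ≠ 0) (x : ℝ × ℝ) :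
    (w.weightedEnergy S k c x (phase c)).im
      = -c.im * (‖shifted S c x‖ * w.kinetic S k c x + w.potential S k c x / ‖shifted S c x‖
          + (shifted S c x * (w.compression S k c x * conj (w.increment S k c S.u x))).re
            / ‖shifted S c x‖
          - S.a x ^ 2
            * (conj (shifted S c x) * (w.divergence S k c x * conj (w.increment S k c S.u x))).re
            / ‖shifted S c x‖ ^ 3) := by
  have hnorm : ‖shifted S c x‖ ≠ 0 := norm_ne_zero_iff.2 (shifted_ne_zero S hc x)
  have hnorm' : (‖shifted S c x‖ : ℂ) ≠ 0 := by exact_mod_cast hnorm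
  have hsq : conj (shifted S c x) * shifted S c x = ‖shifted S c x‖ ^ 2 := conj_mul' _
  have hsplit : w.weightedEnergy S k c x (phase c)
      = (‖shifted S c x‖ * w.kinetic S k c x : ℝ) * shifted S c x
        - (w.potential S k c x / ‖shifted S c x‖ : ℝ) * conj (shifted S c x)
        - (c.im / ‖shifted S c x‖ : ℝ)
          * (I * (shifted S c x * (w.compression S k c x * conj (w.increment S k c S.u x))))
        + (c.im * S.a x ^ 2 / ‖shifted S c x‖ ^ 3 : ℝ) * (I * (conj (shifted S c x)
          * (w.divergence S k c x * conj (w.increment S k c S.u x)))) := by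
    rw [Perturbation.weightedEnergy, deriv_phase hc, phase, ← shifted, Perturbation.pressureRatio]
    generalize ‖shifted S c x‖ = V at *
    push_cast
    field_simp
    linear_combination (V ^ 2 * shifted S c x * w.kinetic S k c x - I * c.im * shifted S c x
      * w.compression S k c x * conj (w.increment S k c S.u x)) * hsq
  rw [hsplit]
  simp only [add_im, sub_im, im_ofReal_mul, I_mul_im, conj_im, shifted_im]
  field_simp
  ring

lemma neg_le_re_mul_conj_div_norm {U : ℂ} (hU : U ≠ 0) (P h : ℂ) {t : ℝ} (ht : 0 < t) :
    -((t * (‖U‖ * ‖P‖ ^ 2) + ‖h‖ ^ 2 / ‖U‖ / t) / 2) ≤ (U * (P * conj h)).re / ‖U‖ := by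
  have hV : 0 < ‖U‖ := norm_pos_iff.2 hU
  have hre : -(‖P‖ * ‖h‖) ≤ (U * (P * conj h)).re / ‖U‖ := by
    rw [le_div_iff₀ hV, neg_mul]
    refine neg_le_of_abs_le ((abs_re_le_norm _).trans_eq ?_)
    rw [norm_mul, norm_mul, norm_conj, mul_comm]
  have hsquare : (t * (‖U‖ * ‖P‖ ^ 2) + ‖h‖ ^ 2 / ‖U‖ / t) / 2 - ‖P‖ * ‖h‖
      = (t * ‖U‖ * ‖P‖ - ‖h‖) ^ 2 / (2 * t * ‖U‖) := by
    field_simp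
    ring
  have : 0 ≤ (t * ‖U‖ * ‖P‖ - ‖h‖) ^ 2 / (2 * t * ‖U‖) := by positivity
  linarith

lemma mul_re_conj_mul_div_norm_cube_le {U : ℂ} (hU : U ≠ 0) (δ h : ℂ) {b β : ℝ} (hb : 0 ≤ b)
    (hβ : b ≤ β * ‖U‖ ^ 2) :
    b * (conj U * (δ * conj h)).re / ‖U‖ ^ 3
      ≤ b * ‖δ‖ ^ 2 / ‖U‖ + β / 4 * (‖h‖ ^ 2 / ‖U‖) := by
  have : 0 < ‖U‖ := norm_pos_iff.2 hU
  have hre : (conj U * (δ * conj h)).re ≤ ‖U‖ * (‖δ‖ * ‖h‖) := by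
    refine (re_le_norm _).trans_eq ?_
    rw [norm_mul, norm_mul, norm_conj, norm_conj]
  have hsquare : b * ‖δ‖ ^ 2 / ‖U‖ + b / ‖U‖ ^ 2 / 4 * (‖h‖ ^ 2 / ‖U‖)
        - b * (‖U‖ * (‖δ‖ * ‖h‖)) / ‖U‖ ^ 3
      = b * (2 * ‖U‖ * ‖δ‖ - ‖h‖) ^ 2 / (4 * ‖U‖ ^ 3) := by
    field_simp
    ring
  calc b * (conj U * (δ * conj h)).re / ‖U‖ ^ 3
      ≤ b * (‖U‖ * (‖δ‖ * ‖h‖)) / ‖U‖ ^ 3 := by gcongr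
    _ ≤ b * ‖δ‖ ^ 2 / ‖U‖ + b / ‖U‖ ^ 2 / 4 * (‖h‖ ^ 2 / ‖U‖) := by
        rw [← sub_nonneg, hsquare]
        positivity
    _ ≤ b * ‖δ‖ ^ 2 / ‖U‖ + β / 4 * (‖h‖ ^ 2 / ‖U‖) := by
        gcongr
        exact (div_le_iff₀ (by positivity)).2 hβ

namespace BaseState.IsAdmissible

variable {R : CrossSection} {S : BaseState} {c : ℂ} {x : ℝ × ℝ}

lemma integrable_norm_shifted_mul (hS : S.IsAdmissible R) (c : ℂ) {f : ℝ × ℝ → ℝ}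
    (hf : Integrable f (S.massMeasure R)) :
    Integrable (fun x => ‖shifted S c x‖ * f x) (S.massMeasure R) :=
  (hS.bddContinuousOn_shifted c).norm.mul_integrable R.isOpen_D.measurableSet (S.ae_mem_D R) hf

lemma integrable_div_norm_shifted (hS : S.IsAdmissible R) (hc : c.im ≠ 0) {f : ℝ × ℝ → ℝ}
    (hf : Integrable f (S.massMeasure R)) :
    Integrable (fun x => f x / ‖shifted S c x‖) (S.massMeasure R) := by
  simp only [div_eq_inv_mul]
  exact (hS.bddContinuousOn_inv_norm_shifted hc).mul_integrable R.isOpen_D.measurableSet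
    (S.ae_mem_D R) hf

lemma a_sq_le_mul_norm_shifted_sq (hS : S.IsAdmissible R) (hc : c.im ≠ 0) (hx : x ∈ R.D) :
    S.a x ^ 2 ≤ S.aMsq R / c.im ^ 2 * ‖shifted S c x‖ ^ 2 := by
  have hmax := hS.a_sq_le hx
  have haM : 0 ≤ S.aMsq R := (sq_nonneg _).trans hmax
  calc S.a x ^ 2 ≤ S.aMsq R / c.im ^ 2 * |c.im| ^ 2 := by
        rwa [sq_abs, div_mul_cancel₀ _ (pow_ne_zero 2 hc)]
    _ ≤ S.aMsq R / c.im ^ 2 * ‖shifted S c x‖ ^ 2 := by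
        gcongr
        exact abs_im_le_norm_shifted S c x

lemma wave_density_le (hS : S.IsAdmissible R) (w : Perturbation) (k : ℝ) (hc : c.im ≠ 0)
    (hx : x ∈ R.D) {t : ℝ} (ht : 0 < t) :
    ‖shifted S c x‖ * w.kinetic S k c x + w.buoyancy S k c x / ‖shifted S c x‖
      ≤ (t * (‖shifted S c x‖ * ‖w.compression S k c x‖ ^ 2)
          + ‖w.increment S k c S.u x‖ ^ 2 / ‖shifted S c x‖ / t) / 2
        + S.aMsq R / c.im ^ 2 / 4 * (‖w.increment S k c S.u x‖ ^ 2 / ‖shifted S c x‖)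
        + (-c.im)⁻¹ * (w.weightedEnergy S k c x (phase c)).im := by
  have hU := shifted_ne_zero S hc x
  have hcompression := neg_le_re_mul_conj_div_norm hU (w.compression S k c x)
    (w.increment S k c S.u x) ht
  have hmagnetic := mul_re_conj_mul_div_norm_cube_le hU (w.divergence S k c x)
    (w.increment S k c S.u x) (sq_nonneg (S.a x)) (hS.a_sq_le_mul_norm_shifted_sq hc hx)
  have hpotential : w.buoyancy S k c x / ‖shifted S c x‖
        + S.a x ^ 2 * ‖w.divergence S k c x‖ ^ 2 / ‖shifted S c x‖
      ≤ w.potential S k c x / ‖shifted S c x‖ := by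
    have hdisp := w.dispSq_nonneg S k c x
    have hline : 0 ≤ k ^ 2 * S.a x ^ 2 * w.dispSq S k c x := by positivity
    have hacoustic : 0 ≤ ‖shifted S c x‖ ^ 4 / S.s x ^ 2 * ‖w.compression S k c x‖ ^ 2 := by
      positivity
    rw [← add_div, Perturbation.potential]
    refine div_le_div_of_nonneg_right ?_ (norm_nonneg _)
    linarith
  rw [w.im_weightedEnergy_phase S k hc, inv_mul_cancel_left₀ (neg_ne_zero.2 hc)]
  linarith

lemma Jm_mul_density_le (hS : S.IsAdmissible R) (w : Perturbation) {k : ℝ} (hk : k ≠ 0)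
    (hc : c.im ≠ 0) (hN : ∀ x ∈ R.D, 0 ≤ S.N1sq x + S.N2sq x) (hx : x ∈ R.D) :
    S.Jm R * (‖w.increment S k c S.u x‖ ^ 2 / ‖shifted S c x‖)
      ≤ w.buoyancy S k c x / ‖shifted S c x‖
        + (1 - S.μ R k c) * (‖shifted S c x‖ * w.kinetic S k c x) := by
  have hV : 0 < ‖shifted S c x‖ := norm_pos_iff.2 (shifted_ne_zero S hc x)
  have hlam : 0 ≤ S.lamM R := (hS.misalignment_nonneg hN hx).trans (hS.misalignment_le hx)
  have hci : c.im ^ 2 ≤ ‖shifted S c x‖ ^ 2 := by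
    rw [← sq_abs]
    gcongr
    exact abs_im_le_norm_shifted S c x
  have hweight : S.lamM R / ‖shifted S c x‖
      ≤ S.lamM R / (k ^ 2 * c.im ^ 2) * (‖shifted S c x‖ * k ^ 2) := by
    calc S.lamM R / ‖shifted S c x‖
        = S.lamM R / (k ^ 2 * ‖shifted S c x‖ ^ 2) * (‖shifted S c x‖ * k ^ 2) := by field_simp
      _ ≤ _ := by gcongr
  have hkinetic : k ^ 2 * w.dispSq S k c x ≤ w.kinetic S k c x :=
    le_add_of_nonneg_right (sq_nonneg _)
  have hdisp := w.dispSq_nonneg S k c x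
  calc S.Jm R * (‖w.increment S k c S.u x‖ ^ 2 / ‖shifted S c x‖)
      ≤ (w.buoyancy S k c x + S.lamM R * w.dispSq S k c x) / ‖shifted S c x‖ := by
        rw [← mul_div_assoc]
        gcongr
        exact hS.Jm_mul_le_buoyancy w k c hx
    _ = w.buoyancy S k c x / ‖shifted S c x‖ + S.lamM R / ‖shifted S c x‖ * w.dispSq S k c x := by
        ring
    _ ≤ w.buoyancy S k c x / ‖shifted S c x‖ + S.lamM R / (k ^ 2 * c.im ^ 2)
          * (‖shifted S c x‖ * k ^ 2) * w.dispSq S k c x := by gcongr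
    _ = w.buoyancy S k c x / ‖shifted S c x‖ + S.lamM R / (k ^ 2 * c.im ^ 2)
          * (‖shifted S c x‖ * (k ^ 2 * w.dispSq S k c x)) := by ring
    _ ≤ _ := by
        rw [BaseState.μ, sub_sub_cancel]
        gcongr

end BaseState.IsAdmissible

namespace IsNormalMode

variable {R : CrossSection} {S : BaseState} {k : ℝ} {c : ℂ} {w : Perturbation}

lemma Jm_mul_integral_le (hw : IsNormalMode R S k c w) (hS : S.IsAdmissible R) (hk : k ≠ 0)
    (hc : c.im ≠ 0) (hN : ∀ x ∈ R.D, 0 ≤ S.N1sq x + S.N2sq x) :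
    S.Jm R * ∫ x, ‖w.increment S k c S.u x‖ ^ 2 / ‖shifted S c x‖ ∂S.massMeasure R
      ≤ ∫ x, w.buoyancy S k c x / ‖shifted S c x‖ ∂S.massMeasure R
        + (1 - S.μ R k c) * ∫ x, ‖shifted S c x‖ * w.kinetic S k c x ∂S.massMeasure R := by
  have hshear := hS.integrable_div_norm_shifted hc (hw.integrable_norm_increment_u_sq hS)
  have hbuoyancy := hS.integrable_div_norm_shifted hc (hw.integrable_buoyancy hS)
  have hkinetic := (hS.integrable_norm_shifted_mul c (hw.integrable_kinetic hS hc)).const_mul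
    (1 - S.μ R k c)
  rw [← integral_const_mul, ← integral_const_mul, ← integral_add hbuoyancy hkinetic]
  exact integral_mono_ae (hshear.const_mul _) (hbuoyancy.add hkinetic)
    ((S.ae_mem_D R).mono fun x hx => hS.Jm_mul_density_le w hk hc hN hx)

lemma integral_wave_le (hw : IsNormalMode R S k c w) (hS : S.IsAdmissible R) (hk : k ≠ 0)
    (hc : c.im ≠ 0) {t : ℝ} (ht : 0 < t) :
    ∫ x, ‖shifted S c x‖ * w.kinetic S k c x ∂S.massMeasure R
        + ∫ x, w.buoyancy S k c x / ‖shifted S c x‖ ∂S.massMeasure R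
      ≤ (t * ∫ x, ‖shifted S c x‖ * ‖w.compression S k c x‖ ^ 2 ∂S.massMeasure R
          + (∫ x, ‖w.increment S k c S.u x‖ ^ 2 / ‖shifted S c x‖ ∂S.massMeasure R) / t) / 2
        + S.aMsq R / c.im ^ 2 / 4
          * ∫ x, ‖w.increment S k c S.u x‖ ^ 2 / ‖shifted S c x‖ ∂S.massMeasure R := by
  have hkinetic := hS.integrable_norm_shifted_mul c (hw.integrable_kinetic hS hc)
  have hbuoyancy := hS.integrable_div_norm_shifted hc (hw.integrable_buoyancy hS)
  have hcompression := (hS.integrable_norm_shifted_mul c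
    (hw.integrable_norm_compression_sq hS hc)).const_mul t
  have hshear := hS.integrable_div_norm_shifted hc (hw.integrable_norm_increment_u_sq hS)
  have hcross := (hcompression.fun_add (hshear.div_const t)).div_const 2
  have hmagnetic := hshear.const_mul (S.aMsq R / c.im ^ 2 / 4)
  have him : Integrable (fun x => (-c.im)⁻¹ * (w.weightedEnergy S k c x (phase c)).im)
      (S.massMeasure R) :=
    (hw.integrable_weightedEnergy hS hk hc (contDiff_phase hc)).im.const_mul _
  have hzero : ∫ x, (-c.im)⁻¹ * (w.weightedEnergy S k c x (phase c)).im ∂S.massMeasure R = 0 := by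
    rw [integral_const_mul, hw.integral_weightedEnergy_im hS hk hc (contDiff_phase hc), mul_zero]
  calc _ = ∫ x, (‖shifted S c x‖ * w.kinetic S k c x
          + w.buoyancy S k c x / ‖shifted S c x‖) ∂S.massMeasure R :=
        (integral_add hkinetic hbuoyancy).symm
    _ ≤ _ := integral_mono_ae (hkinetic.add hbuoyancy) ((hcross.fun_add hmagnetic).fun_add him)
        ((S.ae_mem_D R).mono fun x hx => hS.wave_density_le w k hc hx ht)
    _ = _ := by
        rw [integral_add (hcross.fun_add hmagnetic) him, hzero, add_zero,
          integral_add hcross hmagnetic, integral_div,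
          integral_add hcompression (hshear.div_const t), integral_div, integral_const_mul,
          integral_const_mul]

end IsNormalMode

/-! ### The semi-ellipse bound -/

namespace IsNormalMode

variable {R : CrossSection} {S : BaseState} {k : ℝ} {c : ℂ} {w : Perturbation}

lemma integral_compression_lt (hw : IsNormalMode R S k c w) (hS : S.IsAdmissible R) (hk : k ≠ 0)
    (hc : c.im ≠ 0) :
    ∫ x, ‖shifted S c x‖ * ‖w.compression S k c x‖ ^ 2 ∂S.massMeasure R
      < ∫ x, ‖shifted S c x‖ * w.kinetic S k c x ∂S.massMeasure R := by
  have hcompression := hS.integrable_norm_shifted_mul c (hw.integrable_norm_compression_sq hS hc)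
  have hkinetic := hS.integrable_norm_shifted_mul c (hw.integrable_kinetic hS hc)
  have hpos := hw.integral_mul_dispSq_pos hS hk hc (hS.bddContinuousOn_shifted c).norm
    fun x _ => norm_pos_iff.2 (shifted_ne_zero S hc x)
  rw [← sub_pos, ← integral_sub hkinetic hcompression]
  calc 0 < k ^ 2 * ∫ x, ‖shifted S c x‖ * w.dispSq S k c x ∂S.massMeasure R := by positivity
    _ = _ := by
        rw [← integral_const_mul]
        simp only [Perturbation.kinetic]
        congr with x
        ring

lemma energy_le (hw : IsNormalMode R S k c w) (hS : S.IsAdmissible R) (hk : k ≠ 0)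
    (hc : c.im ≠ 0) (hN : ∀ x ∈ R.D, 0 ≤ S.N1sq x + S.N2sq x) {t : ℝ} (ht : 0 < t) :
    S.μ R k c * ∫ x, ‖shifted S c x‖ * w.kinetic S k c x ∂S.massMeasure R
        + S.Jm R * ∫ x, ‖w.increment S k c S.u x‖ ^ 2 / ‖shifted S c x‖ ∂S.massMeasure R
      ≤ (t * ∫ x, ‖shifted S c x‖ * ‖w.compression S k c x‖ ^ 2 ∂S.massMeasure R
          + (∫ x, ‖w.increment S k c S.u x‖ ^ 2 / ‖shifted S c x‖ ∂S.massMeasure R) / t) / 2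
        + S.aMsq R / c.im ^ 2 / 4
          * ∫ x, ‖w.increment S k c S.u x‖ ^ 2 / ‖shifted S c x‖ ∂S.massMeasure R := by
  linarith [hw.Jm_mul_integral_le hS hk hc hN, hw.integral_wave_le hS hk hc ht]

lemma radicand_pos (hw : IsNormalMode R S k c w) (hS : S.IsAdmissible R) (hk : k ≠ 0)
    (hc : c.im ≠ 0) (hN : ∀ x ∈ R.D, 0 ≤ S.N1sq x + S.N2sq x) (hμ : 0 < S.μ R k c) :
    0 < S.radicand R k c :=
  radicand_pos_of_energy_le hμ (integral_nonneg fun _ => by positivity)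
    (hw.integral_compression_lt hS hk hc) (integral_nonneg fun _ => by positivity)
    fun _ => hw.energy_le hS hk hc hN

lemma mul_integral_kinetic_le_integral_buoyancy_div (hw : IsNormalMode R S k c w)
    (hS : S.IsAdmissible R) (hk : k ≠ 0) (hc : c.im ≠ 0)
    (hN : ∀ x ∈ R.D, 0 ≤ S.N1sq x + S.N2sq x) (hμ : 0 < S.μ R k c) :
    (S.μ R k c + 4 * S.μ R k c ^ 2 * S.Jm R * ((1 + √(S.radicand R k c)) ^ 2)⁻¹ - 1)
        * ∫ x, ‖shifted S c x‖ * w.kinetic S k c x ∂S.massMeasure R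
      ≤ ∫ x, w.buoyancy S k c x / ‖shifted S c x‖ ∂S.massMeasure R := by
  have hshear := mul_le_shear_of_energy_le hμ (integral_nonneg fun _ => by positivity)
    (hw.integral_compression_lt hS hk hc) (integral_nonneg fun _ => by positivity)
    fun _ => hw.energy_le hS hk hc hN
  rw [← BaseState.radicand] at hshear
  have hJ := mul_le_mul_of_nonneg_left hshear (S.Jm_nonneg hN)
  linarith [hw.Jm_mul_integral_le hS hk hc hN]

lemma mul_im_sq_mul_integral_kinetic_le (hw : IsNormalMode R S k c w) (hS : S.IsAdmissible R)
    (hc : c.im ≠ 0) (hN : ∀ x ∈ R.D, 0 ≤ S.N1sq x + S.N2sq x) {e : ℝ} (he : 0 ≤ e)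
    (h : e * ∫ x, ‖shifted S c x‖ * w.kinetic S k c x ∂S.massMeasure R
      ≤ ∫ x, w.buoyancy S k c x / ‖shifted S c x‖ ∂S.massMeasure R) :
    e * c.im ^ 2 * ∫ x, w.kinetic S k c x ∂S.massMeasure R
      ≤ ∫ x, w.buoyancy S k c x ∂S.massMeasure R := by
  have hkinetic : |c.im| * ∫ x, w.kinetic S k c x ∂S.massMeasure R
      ≤ ∫ x, ‖shifted S c x‖ * w.kinetic S k c x ∂S.massMeasure R := by
    rw [← integral_const_mul]
    exact integral_mono ((hw.integrable_kinetic hS hc).const_mul _)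
      (hS.integrable_norm_shifted_mul c (hw.integrable_kinetic hS hc))
      fun x => mul_le_mul_of_nonneg_right (abs_im_le_norm_shifted S c x) (w.kinetic_nonneg S k c x)
  have hbuoyancy : |c.im| * ∫ x, w.buoyancy S k c x / ‖shifted S c x‖ ∂S.massMeasure R
      ≤ ∫ x, w.buoyancy S k c x ∂S.massMeasure R := by
    rw [← integral_const_mul]
    refine integral_mono_ae
      ((hS.integrable_div_norm_shifted hc (hw.integrable_buoyancy hS)).const_mul _)
      (hw.integrable_buoyancy hS) ((S.ae_mem_D R).mono fun x hx => ?_)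
    dsimp only
    rw [mul_div_left_comm]
    exact mul_le_of_le_one_right (hS.buoyancy_nonneg w k c hx (hN x hx))
      (div_le_one_of_le₀ (abs_im_le_norm_shifted S c x) (norm_nonneg _))
  calc e * c.im ^ 2 * ∫ x, w.kinetic S k c x ∂S.massMeasure R
      = |c.im| * (e * (|c.im| * ∫ x, w.kinetic S k c x ∂S.massMeasure R)) := by
        rw [← sq_abs]
        ring
    _ ≤ |c.im| * ∫ x, w.buoyancy S k c x / ‖shifted S c x‖ ∂S.massMeasure R := by
        gcongr
        exact (mul_le_mul_of_nonneg_left hkinetic he).trans h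
    _ ≤ ∫ x, w.buoyancy S k c x ∂S.massMeasure R := hbuoyancy

lemma Gam_sub_one_mul_integral_kinetic_le (hw : IsNormalMode R S k c w) (hS : S.IsAdmissible R)
    (hk : k ≠ 0) (hc : c.im ≠ 0) (hN : ∀ x ∈ R.D, 0 ≤ S.N1sq x + S.N2sq x) :
    (S.Gam R k c - 1) * c.im ^ 2 * ∫ x, w.kinetic S k c x ∂S.massMeasure R
      ≤ ∫ x, w.buoyancy S k c x ∂S.massMeasure R := by
  have hbuoyancy := hS.integral_buoyancy_nonneg w k c hN
  rw [BaseState.Gam]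
  split_ifs with hμ
  · rcases max_cases 1 (S.μ R k c + 4 * S.μ R k c ^ 2 * S.Jm R
      * ((1 + √(S.radicand R k c)) ^ 2)⁻¹) with ⟨hmax, -⟩ | ⟨hmax, hgt⟩ <;> rw [hmax]
    · simpa using hbuoyancy
    · exact hw.mul_im_sq_mul_integral_kinetic_le hS hc hN (sub_nonneg.2 hgt.le)
        (hw.mul_integral_kinetic_le_integral_buoyancy_div hS hk hc hN hμ)
  · simpa using hbuoyancy

lemma semiellipse_le (hw : IsNormalMode R S k c w) (hS : S.IsAdmissible R) (hk : k ≠ 0)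
    (hc : c.im ≠ 0) (hN : ∀ x ∈ R.D, 0 ≤ S.N1sq x + S.N2sq x) :
    (c.re - S.uPlus R) ^ 2 + S.Gam R k c * c.im ^ 2 ≤ S.uMinus R ^ 2 - S.Θ R c := by
  have hproduct : ((c.re - S.uPlus R) ^ 2 + S.Gam R k c * c.im ^ 2 - S.uMinus R ^ 2 + S.Θ R c)
      * ∫ x, w.kinetic S k c x ∂S.massMeasure R ≤ 0 := by
    linarith [hw.semicircle_le hS hk hc, hw.Gam_sub_one_mul_integral_kinetic_le hS hk hc hN]
  linarith [nonpos_of_mul_nonpos_left hproduct (hw.integral_kinetic_pos hS hk hc)]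

lemma im_sq_lt_ciSqBound (hw : IsNormalMode R S k c w) (hS : S.IsAdmissible R) (hk : k ≠ 0)
    (hc : c.im ≠ 0) (hN : ∀ x ∈ R.D, 0 ≤ S.N1sq x + S.N2sq x) (hJ : 1 / 4 < S.Jm R) :
    c.im ^ 2 < S.ciSqBound R k := by
  have hci : 0 < c.im ^ 2 := by positivity
  have hJ' : 0 < 4 * S.Jm R - 1 := by linarith
  have hμ : S.μ R k c = 1 - S.lamM R / k ^ 2 / c.im ^ 2 := by rw [BaseState.μ, div_div]
  rw [BaseState.ciSqBound, mul_assoc _ (S.lamM R / k ^ 2) (S.aMsq R)]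
  set L := S.lamM R / k ^ 2
  rcases lt_or_ge 0 (S.μ R k c) with hμ_pos | hμ_nonpos
  · have hradicand := hw.radicand_pos hS hk hc hN hμ_pos
    have hscaled : S.radicand R k c * (c.im ^ 2) ^ 2
        = (c.im ^ 2) ^ 2 + (c.im ^ 2 - L) * (S.aMsq R - 4 * S.Jm R * c.im ^ 2) := by
      rw [BaseState.radicand, hμ]
      field_simp
    apply lt_larger_root hJ'
    linarith [mul_pos hradicand (pow_pos hci 2)]
  · have hL : c.im ^ 2 ≤ L := by rwa [hμ, sub_nonpos, one_le_div hci] at hμ_nonpos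
    have hL_pos : 0 < L := hci.trans_le hL
    refine hL.trans_lt (lt_larger_root hJ' ?_)
    linarith [pow_pos hL_pos 2]

end IsNormalMode

end MagnetoShear

end

theorem theorem2 (R : MagnetoShear.CrossSection) (S : MagnetoShear.BaseState)
    (hS : S.IsAdmissible R)
    (hN : ∀ x ∈ R.D, 0 ≤ S.N1sq x + S.N2sq x)
    (k : ℝ) (hk : 0 < k) (c : ℂ) (hc : c.im ≠ 0)
    (w : MagnetoShear.Perturbation) (hw : MagnetoShear.IsNormalMode R S k c w) :
    (0 < S.μ R k c → 0 < S.radicand R k c) ∧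
    (c.re - S.uPlus R) ^ 2 + S.Gam R k c * c.im ^ 2 ≤ S.uMinus R ^ 2 - S.Θ R c ∧
    (1 / 4 < S.Jm R → c.im ^ 2 < S.ciSqBound R k) :=
  ⟨hw.radicand_pos hS hk.ne' hc hN, hw.semiellipse_le hS hk.ne' hc hN,
    hw.im_sq_lt_ciSqBound hS hk.ne' hc hN⟩
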